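/- Let $1\le d\le 3$, $2\le p<\infty$, $\gamma_+,\gamma_->0$, $t_+\in(0,1)$, and let $\gamma:\mathbb R\to\mathbb R$ be the $1$-periodic function with $\gamma(t)=\gamma_+$ for $0<t\le t_+$ and $\gamma(t)=-\gamma_-$ for $t_+<t\le 1$. For $\varepsilon>0$, $t_0\in\mathbb R$ and $\varphi\in H^2(\mathbb R^d)$ consider $$ i\partial_t u_\varepsilon+\gamma\!\left(\tfrac t\varepsilon\right)\Delta u_\varepsilon+|u_\varepsilon|^{p-1}u_\varepsilon=0,\qquad u_\varepsilon(t_0,\cdot)=\varphi. \tag{1}$$ A solution of (1) on $[t_0,T]$ is a function $u\in C([t_0,T],H^2(\mathbb R^d))$ with $u(t_0)=\varphi$ that, at every $t\in(t_0,T)$ at which $\gamma(\cdot/\varepsilon)$ does not jump, is differentiable in time with values in $L^2(\mathbb R^d)$ and satisfies the equation in $L^2(\mathbb R^d)$. Let $T^*=T^*(\varphi,t_0,\varepsilon)\in[-\infty,+\infty]$ be the supremum of all $T>t_0$ for which (1) has a solution on $[t_0,T]$. Then: 1. For all $\varepsilon>0$, $t_0\in\mathbb R$ and $\varphi\in H^2(\mathbb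 R^d)$ we have $T^*>t_0$, and there is a function $u_\varepsilon:[t_0,T^*)\to H^2(\mathbb R^d)$ which, for every $t_0<T<T^*$, is a solution of (1) on $[t_0,T]$, and the only one. If $T^*<+\infty$, then $\lim_{t\to T^*,\,t<T^*}\|u_\varepsilon(t,\cdot)\|_{H^2(\mathbb R^d)}=+\infty$. 2. The existence time is bounded below in terms of $\varepsilon$ and the norm of $\varphi$ only: for all $\varepsilon>0$ and $M\in\mathbb R$ there is $\delta>0$ such that $T^*(\varphi,t_0,\varepsilon)\ge t_0+\delta$ for all $t_0\in\mathbb R$ and all $\varphi\in H^2(\mathbb R^d)$ with $\|\varphi\|_{H^2}\le M$. 3. This bound is uniform in $\varepsilon\in(0,1]$: for every $M\in\mathbb R$ there is $\delta>0$ such that $T^*(\varphi,t_0,\varepsilon)\ge t_0+\delta$ for all $\varepsilon\in(0,1]$, all $t_0\in\mathbb R$ and all $\varphi\in H^2(\mathbb R^d)$ with $\|\varphi\|_{H^2}\le M$. In particular $\inf_{0<\varepsilon\le1}T^*(\varphi,t_0,\varepsilon)>t_0$. In 2 and 3, $\delta$ may also depend on the fixed data $d$, $p$, $\gamma_\pm$,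 $t_+$. -/

import Mathlib

open MeasureTheory Filter Topology Set
open scoped Laplacian SchwartzMap

noncomputable section

namespace DispersionNLS

/-- The complex space `L²(ℝᵈ)`. -/
abbrev L2Space (d : ℕ) : Type :=
  Lp ℂ 2 (volume : Measure (EuclideanSpace ℝ (Fin d)))

/-- The tempered distribution given by an `L²` function. -/
abbrev toDistr {d : ℕ} : L2Space d →L[ℂ] 𝓢'(EuclideanSpace ℝ (Fin d), ℂ) :=
  Lp.toTemperedDistributionCLM ℂ volume 2

theorem toDistr_injective {d : ℕ} : Function.Injective (toDistr (d := d)) :=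
  LinearMap.ker_eq_bot.mp (Lp.ker_toTemperedDistributionCLM_eq_bot (F := ℂ) (p := 2))

/-- The functions of `L²(ℝᵈ)` that lie in the Sobolev space `H²(ℝᵈ)`. -/
def sobolevSubmodule (d : ℕ) : Submodule ℂ (L2Space d) where
  carrier := {f | TemperedDistribution.MemSobolev 2 2 (toDistr f)}
  add_mem' {f g} hf hg := by
    have h := TemperedDistribution.MemSobolev.add hf hg
    rwa [← map_add] at h
  zero_mem' := by
    have h := TemperedDistribution.memSobolev_fun_zero
      (EuclideanSpace ℝ (Fin d)) ℂ 2 (p := 2)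
    rwa [← map_zero (toDistr (d := d))] at h
  smul_mem' c f hf := by
    have h := TemperedDistribution.MemSobolev.smul c hf
    rwa [← map_smul] at h

/-- The Sobolev space `H²(ℝᵈ)`, as a type of its own: it carries the `H²` norm defined below and
not the `L²` norm of the submodule. -/
def H2Space (d : ℕ) : Type := sobolevSubmodule d

instance (d : ℕ) : AddCommGroup (H2Space d) :=
  inferInstanceAs (AddCommGroup (sobolevSubmodule d))

instance (d : ℕ) : Module ℂ (H2Space d) :=
  inferInstanceAs (Module ℂ (sobolevSubmodule d))

/-- The inclusion of `H²(ℝᵈ)` into `L²(ℝᵈ)`. -/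
def toL2 {d : ℕ} : H2Space d →ₗ[ℂ] L2Space d := (sobolevSubmodule d).subtype

theorem toL2_injective {d : ℕ} : Function.Injective (toL2 (d := d)) := Subtype.val_injective

/-- An `L²` function in the Sobolev space, as an element of `H²(ℝᵈ)`. -/
def H2Space.mk {d : ℕ} (f : L2Space d)
    (hf : TemperedDistribution.MemSobolev 2 2 (toDistr f)) : H2Space d := ⟨f, hf⟩

theorem toL2_mk {d : ℕ} (f : L2Space d)
    (hf : TemperedDistribution.MemSobolev 2 2 (toDistr f)) : toL2 (H2Space.mk f hf) = f := rfl

theorem memSobolev_toL2 {d : ℕ} (f : H2Space d) :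
    TemperedDistribution.MemSobolev 2 2 (toDistr (toL2 f)) := f.2

/-- The Bessel potential `𝓕⁻¹ (1 + |ξ|²) 𝓕 f` of `f ∈ H²`, an element of `L²`. -/
def besselFun {d : ℕ} (f : H2Space d) : L2Space d := (memSobolev_toL2 f).choose

theorem toDistr_besselFun {d : ℕ} (f : H2Space d) :
    toDistr (besselFun f) =
      TemperedDistribution.besselPotential (EuclideanSpace ℝ (Fin d)) ℂ 2 (toDistr (toL2 f)) :=
  (memSobolev_toL2 f).choose_spec.symm

/-- `besselFun` as a linear map. -/
def bessel {d : ℕ} : H2Space d →ₗ[ℂ] L2Space d where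
  toFun := besselFun
  map_add' f g := toDistr_injective (by simp only [toDistr_besselFun, map_add])
  map_smul' c f := toDistr_injective (by
    simp only [toDistr_besselFun, map_smul, RingHom.id_apply])

theorem bessel_injective {d : ℕ} : Function.Injective (bessel (d := d)) := by
  intro f g h
  have h' := congrArg toDistr h
  change toDistr (besselFun f) = toDistr (besselFun g) at h'
  rw [toDistr_besselFun, toDistr_besselFun] at h'
  apply toL2_injective
  apply toDistr_injective
  rw [← TemperedDistribution.besselPotential_neg_apply_eq_iff,
    (TemperedDistribution.besselPotential_neg_apply_eq_iff 2 _ _).mpr rfl] at h'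
  exact h'.symm

/-- The `H²` norm `‖f‖ = ‖𝓕⁻¹ (1 + |ξ|²) 𝓕 f‖_{L²}`. -/
instance (d : ℕ) : NormedAddCommGroup (H2Space d) :=
  NormedAddCommGroup.induced (H2Space d) (L2Space d) bessel bessel_injective

instance (d : ℕ) : NormedSpace ℂ (H2Space d) :=
  NormedSpace.induced ℂ (H2Space d) (L2Space d) bessel

theorem exists_laplacian {d : ℕ} (f : H2Space d) :
    ∃ g : L2Space d, toDistr g = Δ (toDistr (toL2 f)) := by
  have h := (memSobolev_toL2 f).laplacian
  rw [sub_self, TemperedDistribution.memSobolev_zero_iff] at h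
  obtain ⟨g, hg⟩ := h
  exact ⟨g, hg.symm⟩

/-- The Laplacian `Δ f ∈ L²` of `f ∈ H²`, in the sense of distributions. -/
def laplace {d : ℕ} (f : H2Space d) : L2Space d := (exists_laplacian f).choose

theorem toDistr_laplace {d : ℕ} (f : H2Space d) :
    toDistr (laplace f) = Δ (toDistr (toL2 f)) := (exists_laplacian f).choose_spec

/-- The `1`-periodic dispersion map: `γ₊` on `(n, n + t₊]` and `-γ₋` on `(n + t₊, n + 1]` for
every integer `n`. -/
def dispersionMap (γp γm tp t : ℝ) : ℝ :=
  if 0 < Int.fract t ∧ Int.fract t ≤ tp then γp else -γm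

/-- `u ∈ C([t₀, T]; H²)` solves `i ∂ₜu + γ(t/ε) Δu + |u|^{p-1} u = 0`, `u(t₀) = φ`: the equation
holds in `L²`, with the strong time derivative in `L²`, at every time of `(t₀, T)` at which
`γ(·/ε)` does not jump. -/
structure IsSolutionOn {d : ℕ} (p γp γm tp ε t₀ : ℝ) (φ : H2Space d) (T : ℝ)
    (u : ℝ → H2Space d) : Prop where
  continuousOn : ContinuousOn u (Icc t₀ T)
  initial : u t₀ = φ
  equation : ∀ t ∈ Ioo t₀ T, ContinuousAt (fun s => dispersionMap γp γm tp (s / ε)) t →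
    ∃ u' : L2Space d, HasDerivAt (fun s => toL2 (u s)) u' t ∧
      ∀ᵐ x : EuclideanSpace ℝ (Fin d),
        Complex.I * u' x + (dispersionMap γp γm tp (t / ε) : ℂ) * laplace (u t) x
          + ((‖toL2 (u t) x‖ ^ (p - 1) : ℝ) : ℂ) * toL2 (u t) x = 0

/-- The maximal time of existence `T*`: the supremum, in the extended reals, of all `T > t₀` for
which a solution in `C([t₀, T]; H²)` exists. -/
def maxTime {d : ℕ} (p γp γm tp ε t₀ : ℝ) (φ : H2Space d) : EReal :=
  sSup {τ : EReal | ∃ T : ℝ, τ = T ∧ t₀ < T ∧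
    ∃ u : ℝ → H2Space d, IsSolutionOn p γp γm tp ε t₀ φ T u}

end DispersionNLS

end

open scoped SchwartzMap ENNReal FourierTransform RealInnerProductSpace ContDiff
open scoped ComplexConjugate NNReal

noncomputable section

namespace DispersionNLS

/-! Let `a` be a primitive of `γ(·/ε)` and pass to the interaction picture `z = exp(-iaΔ) u`. The
equation becomes `z' = i exp(-iaΔ) N(exp(iaΔ) z)` with `N(f) = |f|^(p-1) f`. The dispersion now
enters only through operators that are isometric on both `L²` and `H²`, so no constant of the
existence theory sees `a`. Hence the existence time depends on the `H²` norm of the datum alone,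
uniformly in `ε` and `t₀`.

Local existence (`exists_integral_solution`, `exists_isMildOn`) is a fixed point argument with two
norms: the map contracts in the `L²` metric on functions with values in a ball of `H²`, which is
closed in `L²`. It needs `N` to be Lipschitz in `L²` on `H²` balls (`exists_lipschitz_eq_nonlin`,
from the embedding of `H²` into `L^∞` for `d ≤ 3`) and bounded from `H²` balls to `H²`
(`exists_nonlin_H2_bound`); a Lipschitz bound in `H²` is not required.

Since `|z|^(p-1) z` need not be twice differentiable at the origin, the `H²` bound avoids the chain
rule. Membership in `H²` is read off from second differences being `O(|h|²)` in `L²`. Pointwise, a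
second difference of `N(f)` is bounded by the second difference of `f` plus the square of a first
difference, and a discrete Gagliardo–Nirenberg inequality controls the latter.

Strong and Duhamel solutions coincide, because the jumps of `γ(·/ε)` are countable and the
fundamental theorem of calculus tolerates a countable exceptional set. Uniqueness is Gronwall's
inequality in `L²`, and blow-up follows by restarting near the maximal time with the uniform
existence time. -/

/-! ### Pointwise estimates for the power nonlinearity. -/

/-- The tangent line of the convex function `t ^ q` at `y` lies below its graph; this is Bernoulli's
inequality for `x / y`. -/
theorem rpow_sub_rpow_le {q x y : ℝ} (hq : 1 ≤ q) (hx : 0 ≤ x) (hy : 0 ≤ y) :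
    y ^ q - x ^ q ≤ q * y ^ (q - 1) * (y - x) := by
  rcases hy.eq_or_lt with rfl | hy
  · rw [Real.zero_rpow (by linarith)]
    -- At `q = 1` the slope at zero is `0 ^ 0 = 1`; for `q > 1` it vanishes.
    rcases hq.eq_or_lt with rfl | hq
    · simp
    · rw [Real.zero_rpow (by linarith)]
      have := Real.rpow_nonneg hx q
      linarith
  · have h := one_add_mul_self_le_rpow_one_add (s := x / y - 1)
      (by have : 0 ≤ x / y := by positivity
          linarith) hq
    rw [show 1 + (x / y - 1) = x / y by ring, Real.div_rpow hx hy.le,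
      le_div_iff₀ (by positivity)] at h
    have e : y ^ q = y ^ (q - 1) * y := by
      rw [← Real.rpow_add_one hy.ne']; simp
    have : (1 + q * (x / y - 1)) * y ^ q = y ^ q - q * y ^ (q - 1) * (y - x) := by
      rw [e]; field_simp; ring
    linarith

theorem abs_rpow_sub_rpow_le {q M x y : ℝ} (hq : 1 ≤ q) (hx : 0 ≤ x) (hy : 0 ≤ y)
    (hxM : x ≤ M) (hyM : y ≤ M) : |y ^ q - x ^ q| ≤ q * M ^ (q - 1) * |y - x| := by
  have hx' : x ^ (q - 1) ≤ M ^ (q - 1) := Real.rpow_le_rpow hx hxM (by linarith)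
  have hy' : y ^ (q - 1) ≤ M ^ (q - 1) := Real.rpow_le_rpow hy hyM (by linarith)
  have h1 := rpow_sub_rpow_le hq hx hy
  have h2 := rpow_sub_rpow_le hq hy hx
  have hx0 := Real.rpow_nonneg hx (q - 1)
  have hy0 := Real.rpow_nonneg hy (q - 1)
  have a1 : q * y ^ (q - 1) * (y - x) ≤ q * M ^ (q - 1) * |y - x| :=
    (mul_le_mul_of_nonneg_left (le_abs_self _) (by positivity)).trans (by gcongr)
  have a2 : q * x ^ (q - 1) * (x - y) ≤ q * M ^ (q - 1) * |y - x| := by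
    rw [abs_sub_comm]
    exact (mul_le_mul_of_nonneg_left (le_abs_self _) (by positivity)).trans (by gcongr)
  rw [abs_le]
  constructor <;> linarith

/-- For `s < 1` the power `t ^ s` is not Lipschitz at zero. The factor `r` repairs this: up to `x ^
s * (x - r)`, the product is a difference of powers of exponent `s + 1 ≥ 1`. -/
theorem mul_abs_rpow_sub_rpow_le {s M x r : ℝ} (hs : 0 ≤ s) (hx : 0 ≤ x) (hr : 0 ≤ r)
    (hxM : x ≤ M) (hrM : r ≤ M) :
    r * |x ^ s - r ^ s| ≤ (s + 2) * M ^ s * |x - r| := by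
  have hM : 0 ≤ M := hx.trans hxM
  have h := abs_rpow_sub_rpow_le (q := s + 1) (by linarith) hr hx hrM hxM
  rw [add_sub_cancel_right] at h
  have ex : x ^ (s + 1) = x ^ s * x := Real.rpow_add_one' hx (by linarith)
  have er : r ^ (s + 1) = r ^ s * r := Real.rpow_add_one' hr (by linarith)
  rw [← abs_of_nonneg hr, ← abs_mul, abs_of_nonneg hr]
  have e : r * (x ^ s - r ^ s) = -(x ^ s * (x - r)) + (x ^ (s + 1) - r ^ (s + 1)) := by
    rw [ex, er]; ring
  rw [e]
  refine (abs_add_le _ _).trans ?_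
  rw [abs_neg, abs_mul, abs_of_nonneg (Real.rpow_nonneg hx s)]
  have : x ^ s * |x - r| ≤ M ^ s * |x - r| := by gcongr
  linarith

/-- The power nonlinearity `|z|^q z`. -/
def powNL (q : ℝ) (z : ℂ) : ℂ := ((‖z‖ ^ q : ℝ) : ℂ) * z

theorem norm_powNL (q : ℝ) (z : ℂ) : ‖powNL q z‖ = ‖z‖ ^ q * ‖z‖ := by
  rw [powNL, norm_mul, Complex.norm_real, Real.norm_of_nonneg (by positivity)]

theorem norm_powNL_sub_le {q M : ℝ} (hq : 1 ≤ q) {a b : ℂ} (ha : ‖a‖ ≤ M) (hb : ‖b‖ ≤ M) :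
    ‖powNL q a - powNL q b‖ ≤ (q + 1) * M ^ q * ‖a - b‖ := by
  have hM : 0 ≤ M := (norm_nonneg a).trans ha
  have e : powNL q a - powNL q b
      = ((‖a‖ ^ q : ℝ) : ℂ) * (a - b) + ((‖a‖ ^ q - ‖b‖ ^ q : ℝ) : ℂ) * b := by
    simp only [powNL]; push_cast; ring
  rw [e]
  refine (norm_add_le _ _).trans ?_
  rw [norm_mul, norm_mul, Complex.norm_real, Complex.norm_real,
    Real.norm_of_nonneg (by positivity), Real.norm_eq_abs]
  have h1 : ‖a‖ ^ q ≤ M ^ q := Real.rpow_le_rpow (norm_nonneg _) ha (by linarith)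
  have h2 := abs_rpow_sub_rpow_le hq (norm_nonneg b) (norm_nonneg a) hb ha
  have h3 : |‖a‖ - ‖b‖| ≤ ‖a - b‖ := abs_norm_sub_norm_le a b
  have h4 : M ^ q = M ^ (q - 1) * M := by
    rw [← Real.rpow_add_one' hM (by linarith)]; simp
  calc _ ≤ M ^ q * ‖a - b‖ + q * M ^ (q - 1) * ‖a - b‖ * M := by gcongr; exact h2.trans (by gcongr)
    _ = _ := by rw [h4]; ring

/-- The second difference of `‖z‖ ^ q` need not be quadratic in `w` near the origin, but it is after
multiplication by `‖b‖`. It is nonnegative by convexity and the triangle inequality. From above, the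
tangent lines at `x` and `y` are used: replacing their slopes by the slope at `r` costs a quadratic
error by `mul_abs_rpow_sub_rpow_le`, and the remaining `r * (x + y - 2 * r)` is at most `‖w‖ ^ 2` by
the parallelogram law. -/
theorem norm_mul_second_diff_rpow_le {q M : ℝ} (hq : 1 ≤ q) {b w : ℂ} (hb : ‖b‖ ≤ M)
    (h1 : ‖b + w‖ ≤ M) (h2 : ‖b - w‖ ≤ M) :
    ‖b‖ * |‖b + w‖ ^ q + ‖b - w‖ ^ q - 2 * ‖b‖ ^ q| ≤
      q * (2 * q + 3) * M ^ (q - 1) * ‖w‖ ^ 2 := by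
  have hM : 0 ≤ M := (norm_nonneg b).trans hb
  set r := ‖b‖ with hr
  set x := ‖b + w‖ with hx
  set y := ‖b - w‖ with hy
  have r0 : 0 ≤ r := norm_nonneg _
  have x0 : 0 ≤ x := norm_nonneg _
  have y0 : 0 ≤ y := norm_nonneg _
  have par : x ^ 2 + y ^ 2 = 2 * r ^ 2 + 2 * ‖w‖ ^ 2 := by
    have := parallelogram_law_with_norm ℝ b w
    rw [hx, hy, hr]
    linarith
  have tri : 2 * r ≤ x + y := by
    have : ‖(2 : ℂ) * b‖ ≤ x + y := by
      rw [show (2 : ℂ) * b = (b + w) + (b - w) by ring]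
      exact norm_add_le _ _
    simpa using this
  have hxr : |x - r| ≤ ‖w‖ := by
    simpa using abs_norm_sub_norm_le (b + w) b
  have hyr : |y - r| ≤ ‖w‖ := by
    simpa using abs_norm_sub_norm_le (b - w) b
  have key : r * (x + y - 2 * r) ≤ ‖w‖ ^ 2 := by nlinarith [sq_nonneg (x - y)]
  have bx := rpow_sub_rpow_le hq r0 x0
  have by' := rpow_sub_rpow_le hq r0 y0
  have lx := rpow_sub_rpow_le hq x0 r0
  have ly := rpow_sub_rpow_le hq y0 r0
  have mx := mul_abs_rpow_sub_rpow_le (s := q - 1) (by linarith) x0 r0 h1 hb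
  have my := mul_abs_rpow_sub_rpow_le (s := q - 1) (by linarith) y0 r0 h2 hb
  have rM : r ^ (q - 1) ≤ M ^ (q - 1) := Real.rpow_le_rpow r0 hb (by linarith)
  have rq0 : 0 ≤ r ^ (q - 1) := Real.rpow_nonneg r0 _
  have Mq0 : 0 ≤ M ^ (q - 1) := Real.rpow_nonneg hM _
  have low : 0 ≤ x ^ q + y ^ q - 2 * r ^ q := by
    have : 0 ≤ q * r ^ (q - 1) * (x + y - 2 * r) := by
      have := sub_nonneg.2 tri
      positivity
    linarith
  rw [abs_of_nonneg low]
  have cx : r * (x ^ (q - 1) - r ^ (q - 1)) * (x - r) ≤ (q + 1) * M ^ (q - 1) * ‖w‖ ^ 2 := by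
    calc _ ≤ |r * (x ^ (q - 1) - r ^ (q - 1)) * (x - r)| := le_abs_self _
      _ = r * |x ^ (q - 1) - r ^ (q - 1)| * |x - r| := by
        rw [abs_mul, abs_mul, abs_of_nonneg r0]
      _ ≤ ((q - 1 + 2) * M ^ (q - 1) * |x - r|) * |x - r| := by gcongr
      _ ≤ ((q - 1 + 2) * M ^ (q - 1) * ‖w‖) * ‖w‖ := by
        have : 0 ≤ q - 1 + 2 := by linarith
        gcongr
      _ = _ := by ring
  have cy : r * (y ^ (q - 1) - r ^ (q - 1)) * (y - r) ≤ (q + 1) * M ^ (q - 1) * ‖w‖ ^ 2 := by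
    calc _ ≤ |r * (y ^ (q - 1) - r ^ (q - 1)) * (y - r)| := le_abs_self _
      _ = r * |y ^ (q - 1) - r ^ (q - 1)| * |y - r| := by
        rw [abs_mul, abs_mul, abs_of_nonneg r0]
      _ ≤ ((q - 1 + 2) * M ^ (q - 1) * |y - r|) * |y - r| := by gcongr
      _ ≤ ((q - 1 + 2) * M ^ (q - 1) * ‖w‖) * ‖w‖ := by
        have : 0 ≤ q - 1 + 2 := by linarith
        gcongr
      _ = _ := by ring
  have ck : r ^ (q - 1) * (r * (x + y - 2 * r)) ≤ M ^ (q - 1) * ‖w‖ ^ 2 := by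
    calc _ ≤ r ^ (q - 1) * ‖w‖ ^ 2 := by gcongr
      _ ≤ _ := by gcongr
  have q0 : 0 ≤ q := by linarith
  have s1 := mul_le_mul_of_nonneg_left (add_le_add bx by') r0
  have s2 := mul_le_mul_of_nonneg_left (add_le_add (add_le_add cx cy) ck) q0
  linarith

theorem norm_powNL_second_diff_symm_le {q M : ℝ} (hq : 1 ≤ q) {b w : ℂ} (hb : ‖b‖ ≤ M)
    (h1 : ‖b + w‖ ≤ M) (h2 : ‖b - w‖ ≤ M) :
    ‖powNL q (b + w) - 2 * powNL q b + powNL q (b - w)‖ ≤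
      q * (2 * q + 5) * M ^ (q - 1) * ‖w‖ ^ 2 := by
  have hM : 0 ≤ M := (norm_nonneg b).trans hb
  have e : powNL q (b + w) - 2 * powNL q b + powNL q (b - w) =
      ((‖b + w‖ ^ q + ‖b - w‖ ^ q - 2 * ‖b‖ ^ q : ℝ) : ℂ) * b +
        ((‖b + w‖ ^ q - ‖b - w‖ ^ q : ℝ) : ℂ) * w := by
    simp only [powNL]; push_cast; ring
  rw [e]
  refine (norm_add_le _ _).trans ?_
  rw [norm_mul, norm_mul, Complex.norm_real, Complex.norm_real, Real.norm_eq_abs, Real.norm_eq_abs]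
  have k1 := norm_mul_second_diff_rpow_le hq hb h1 h2
  have k2 := abs_rpow_sub_rpow_le hq (norm_nonneg (b - w)) (norm_nonneg (b + w)) h2 h1
  have k3 : |‖b + w‖ - ‖b - w‖| ≤ 2 * ‖w‖ := by
    refine (abs_norm_sub_norm_le _ _).trans ?_
    rw [show b + w - (b - w) = 2 * w by ring]
    simp
  have k4 : |‖b + w‖ ^ q - ‖b - w‖ ^ q| * ‖w‖ ≤ q * M ^ (q - 1) * (2 * ‖w‖) * ‖w‖ := by
    gcongr
    exact k2.trans (by gcongr)
  linarith

theorem exists_norm_powNL_second_diff_le {q : ℝ} (hq : 1 ≤ q) {M : ℝ} (hM : 0 ≤ M) :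
    ∃ C, 0 ≤ C ∧ ∀ a b c : ℂ, ‖a‖ ≤ M → ‖b‖ ≤ M → ‖c‖ ≤ M →
      ‖powNL q a - 2 * powNL q b + powNL q c‖ ≤ C * (‖a - 2 * b + c‖ + ‖a - b‖ ^ 2) := by
  refine ⟨(q + 1) * (3 * M) ^ q + q * (2 * q + 5) * (3 * M) ^ (q - 1), by positivity, ?_⟩
  intro a b c ha hb hc
  have hM3 : M ≤ 3 * M := by linarith
  -- The reflection of `a` in `b` makes the triple symmetric. It differs from `c` by exactly `a - 2
  -- * b + c`, which the Lipschitz bound absorbs.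
  have hba : ‖b - (a - b)‖ ≤ 3 * M := by
    calc ‖b - (a - b)‖ = ‖b + b - a‖ := by congr 1; ring
      _ ≤ ‖b‖ + ‖b‖ + ‖a‖ := (norm_sub_le _ _).trans (by gcongr; exact norm_add_le _ _)
      _ ≤ 3 * M := by linarith
  have e : powNL q a - 2 * powNL q b + powNL q c =
      (powNL q c - powNL q (b - (a - b))) +
        (powNL q (b + (a - b)) - 2 * powNL q b + powNL q (b - (a - b))) := by
    rw [show b + (a - b) = a by ring]; ring
  have k1 := norm_powNL_sub_le hq (hc.trans hM3) hba
  have k2 := norm_powNL_second_diff_symm_le (w := a - b) hq (hb.trans hM3)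
    (by rw [show b + (a - b) = a by ring]; exact ha.trans hM3) hba
  rw [show c - (b - (a - b)) = a - 2 * b + c by ring] at k1
  rw [e]
  refine (norm_add_le _ _).trans ((add_le_add k1 k2).trans ?_)
  have p1 : 0 ≤ (q + 1) * (3 * M) ^ q := by positivity
  have p2 : 0 ≤ q * (2 * q + 5) * (3 * M) ^ (q - 1) := by positivity
  nlinarith [mul_nonneg p1 (sq_nonneg ‖a - b‖), mul_nonneg p2 (norm_nonneg (a - 2 * b + c))]

/-- The power nonlinearity with the modulus in the power cut off at `K`. -/
def cutNL (q K : ℝ) (z : ℂ) : ℂ := (((min ‖z‖ K) ^ q : ℝ) : ℂ) * z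

theorem cutNL_eq_powNL {q K : ℝ} {z : ℂ} (h : ‖z‖ ≤ K) : cutNL q K z = powNL q z := by
  rw [cutNL, powNL, min_eq_left h]

theorem cutNL_zero (q K : ℝ) : cutNL q K 0 = 0 := by simp [cutNL]

/-- A globally Lipschitz function vanishing at zero acts on all of `L²` as a Lipschitz map. The
cut-off provides one that agrees with the nonlinearity where the modulus is at most `K`. -/
theorem lipschitzWith_cutNL {q K : ℝ} (hq : 1 ≤ q) (hK : 0 ≤ K) :
    LipschitzWith ((q + 1) * K ^ q).toNNReal (cutNL q K) := by
  have key : ∀ a b : ℂ, ‖b‖ ≤ ‖a‖ → ‖cutNL q K a - cutNL q K b‖ ≤ (q + 1) * K ^ q * ‖a - b‖ := by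
    intro a b hab
    have e : cutNL q K a - cutNL q K b = (((min ‖a‖ K) ^ q : ℝ) : ℂ) * (a - b) +
        (((min ‖a‖ K) ^ q - (min ‖b‖ K) ^ q : ℝ) : ℂ) * b := by
      simp only [cutNL]; push_cast; ring
    have ma : 0 ≤ min ‖a‖ K := le_min (norm_nonneg _) hK
    have mb : 0 ≤ min ‖b‖ K := le_min (norm_nonneg _) hK
    rw [e]
    refine (norm_add_le _ _).trans ?_
    rw [norm_mul, norm_mul, Complex.norm_real, Complex.norm_real,
      Real.norm_of_nonneg (by positivity), Real.norm_eq_abs]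
    have h1 : (min ‖a‖ K) ^ q ≤ K ^ q := Real.rpow_le_rpow ma (min_le_right _ _) (by linarith)
    have h2 := abs_rpow_sub_rpow_le hq mb ma (min_le_right _ _) (min_le_right _ _)
    have h4 : K ^ q = K ^ (q - 1) * K := by
      rw [← Real.rpow_add_one' hK (by linarith)]; simp
    have h3 : |(min ‖a‖ K) ^ q - (min ‖b‖ K) ^ q| * ‖b‖ ≤ q * K ^ q * ‖a - b‖ := by
      -- If the smaller modulus exceeds `K`, both cut-offs equal `K` and the difference vanishes;
      -- otherwise the factor `‖b‖` is at most `K`.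
      rcases le_total K ‖b‖ with hb | hb
      · rw [min_eq_right hb, min_eq_right (hb.trans hab)]
        simp only [sub_self, abs_zero, zero_mul]
        positivity
      · have h5 : |min ‖a‖ K - min ‖b‖ K| ≤ ‖a - b‖ := by
          rw [min_eq_left hb, abs_of_nonneg (sub_nonneg.2 (le_min hab hb))]
          exact (sub_le_sub_right (min_le_left _ _) _).trans (norm_sub_norm_le a b)
        calc _ ≤ q * K ^ (q - 1) * ‖a - b‖ * K := by gcongr; exact h2.trans (by gcongr)
          _ = _ := by rw [h4]; ring
    calc _ ≤ K ^ q * ‖a - b‖ + q * K ^ q * ‖a - b‖ := by gcongr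
      _ = _ := by ring
  refine LipschitzWith.of_dist_le_mul fun a b => ?_
  rw [Real.coe_toNNReal _ (by positivity), dist_eq_norm, dist_eq_norm]
  rcases le_total ‖b‖ ‖a‖ with h | h
  · exact key a b h
  · rw [norm_sub_rev, norm_sub_rev a b]
    exact key b a h

theorem continuous_powNL {q : ℝ} (hq : 0 ≤ q) : Continuous (powNL q) := by
  unfold powNL
  exact (Complex.continuous_ofReal.comp (continuous_norm.rpow_const fun _ => Or.inr hq)).mul
    continuous_id

/-! ### Fourier multipliers on `L²` and the Fourier description of `H²`. -/

theorem norm_eq_norm_bessel {d : ℕ} (f : H2Space d) : ‖f‖ = ‖bessel f‖ := rfl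

theorem toDistr_bessel {d : ℕ} (f : H2Space d) :
    toDistr (bessel f) =
      TemperedDistribution.besselPotential (EuclideanSpace ℝ (Fin d)) ℂ 2 (toDistr (toL2 f)) :=
  toDistr_besselFun f

theorem toDistr_fourier {d : ℕ} (f : L2Space d) : toDistr (𝓕 f) = 𝓕 (toDistr f) :=
  (Lp.fourier_toTemperedDistribution_eq f).symm

theorem toDistr_fourierInv {d : ℕ} (f : L2Space d) : toDistr (𝓕⁻ f) = 𝓕⁻ (toDistr f) :=
  (Lp.fourierInv_toTemperedDistribution_eq f).symm

/-- The Fourier multiplier with an essentially bounded symbol, on `L²`. -/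
def multCLM {d : ℕ} {b : EuclideanSpace ℝ (Fin d) → ℂ} (hb : MemLp b ∞) :
    L2Space d →L[ℂ] L2Space d :=
  LinearMap.mkContinuous
    { toFun := fun f => 𝓕⁻ (hb.toLp b • 𝓕 f : L2Space d)
      map_add' := fun f g => by
        rw [FourierTransform.fourier_add, Lp.add_smul, FourierTransform.fourierInv_add]
      map_smul' := fun c f => by
        rw [FourierTransform.fourier_smul, ← Lp.smul_comm, FourierTransform.fourierInv_smul]; rfl }
    ‖hb.toLp b‖ fun f => by
      have h1 : ‖(𝓕⁻ (hb.toLp b • 𝓕 f : L2Space d) : L2Space d)‖ = ‖(hb.toLp b • 𝓕 f : L2Space d)‖ :=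
        (Lp.fourierTransformₗᵢ (EuclideanSpace ℝ (Fin d)) ℂ).symm.norm_map _
      change ‖(𝓕⁻ (hb.toLp b • 𝓕 f : L2Space d) : L2Space d)‖ ≤ _
      rw [h1]
      refine (Lp.norm_smul_le _ _).trans ?_
      rw [Lp.norm_fourier_eq]

theorem multCLM_apply {d : ℕ} {b : EuclideanSpace ℝ (Fin d) → ℂ} (hb : MemLp b ∞)
    (f : L2Space d) : multCLM hb f = 𝓕⁻ (hb.toLp b • 𝓕 f : L2Space d) := rfl

theorem fourier_multCLM {d : ℕ} {b : EuclideanSpace ℝ (Fin d) → ℂ} (hb : MemLp b ∞)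
    (f : L2Space d) : (𝓕 (multCLM hb f) : L2Space d) =ᵐ[volume] fun ξ => b ξ * (𝓕 f : L2Space d) ξ := by
  rw [multCLM_apply, FourierTransform.fourier_fourierInv_eq]
  filter_upwards [Lp.coeFn_lpSMul (r := 2) (hb.toLp b) (𝓕 f : L2Space d), hb.coeFn_toLp] with ξ h1 h2
  rw [h1, Pi.smul_apply', h2, smul_eq_mul]

theorem fourierMultiplierCLM_toDistr {d : ℕ} {b : EuclideanSpace ℝ (Fin d) → ℂ}
    (hg : b.HasTemperateGrowth) (hb : MemLp b ∞) (f : L2Space d) :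
    TemperedDistribution.fourierMultiplierCLM ℂ b (toDistr f) = toDistr (multCLM hb f) := by
  rw [TemperedDistribution.fourierMultiplierCLM_apply, multCLM_apply, toDistr_fourierInv,
    ← toDistr_fourier]
  congr 1
  exact (Lp.toTemperedDistribution_smul_eq hg hb (𝓕 f : L2Space d)).symm

theorem fourier_ext {d : ℕ} {f g : L2Space d}
    (h : (𝓕 f : L2Space d) =ᵐ[volume] (𝓕 g : L2Space d)) : f = g :=
  (Lp.fourierTransformₗᵢ (EuclideanSpace ℝ (Fin d)) ℂ).injective (Lp.ext h)

theorem memLp_top_of_continuous_of_bound {d : ℕ} {b : EuclideanSpace ℝ (Fin d) → ℂ} (hb : Continuous b) (C : ℝ)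
    (h : ∀ ξ, ‖b ξ‖ ≤ C) : MemLp b ∞ :=
  MeasureTheory.memLp_top_of_bound hb.aestronglyMeasurable C (Eventually.of_forall h)

theorem norm_inv_one_add_le {d : ℕ} (ξ : EuclideanSpace ℝ (Fin d)) :
    ‖(((1 + ‖ξ‖ ^ 2) ^ (-2 / 2 : ℝ) : ℝ) : ℂ)‖ ≤ 1 := by
  rw [Complex.norm_real, Real.norm_of_nonneg (by positivity)]
  exact Real.rpow_le_one_of_one_le_of_nonpos (by nlinarith [sq_nonneg ‖ξ‖]) (by norm_num)

theorem memLp_bessel_symbol (d : ℕ) : MemLp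
    (fun ξ : EuclideanSpace ℝ (Fin d) => (((1 + ‖ξ‖ ^ 2) ^ (-2 / 2 : ℝ) : ℝ) : ℂ)) ∞ := by
  refine memLp_top_of_continuous_of_bound ?_ 1 norm_inv_one_add_le
  have : (fun ξ : EuclideanSpace ℝ (Fin d) =>
    (((1 + ‖ξ‖ ^ 2) ^ (-2 / 2 : ℝ) : ℝ) : ℂ)).HasTemperateGrowth := by fun_prop
  exact this.1.continuous

theorem besselPotential_neg_toDistr {d : ℕ} (g : L2Space d) :
    TemperedDistribution.besselPotential (EuclideanSpace ℝ (Fin d)) ℂ (-2) (toDistr g) =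
      toDistr (multCLM (memLp_bessel_symbol d) g) :=
  fourierMultiplierCLM_toDistr (by fun_prop) _ _

theorem bessel_symbol_eq {d : ℕ} (ξ : EuclideanSpace ℝ (Fin d)) :
    (((1 + ‖ξ‖ ^ 2) ^ (-2 / 2 : ℝ) : ℝ) : ℂ) = ((1 + ‖ξ‖ ^ 2 : ℝ) : ℂ)⁻¹ := by
  rw [show (-2 / 2 : ℝ) = -1 by norm_num, Real.rpow_neg_one, Complex.ofReal_inv]

theorem one_add_norm_sq_ne_zero {d : ℕ} (ξ : EuclideanSpace ℝ (Fin d)) :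
    ((1 + ‖ξ‖ ^ 2 : ℝ) : ℂ) ≠ 0 :=
  Complex.ofReal_ne_zero.2 (by positivity)

theorem toL2_eq_multCLM_bessel {d : ℕ} (f : H2Space d) :
    toL2 f = multCLM (memLp_bessel_symbol d) (bessel f) := by
  apply toDistr_injective
  rw [← besselPotential_neg_toDistr, eq_comm, TemperedDistribution.besselPotential_neg_apply_eq_iff,
    toDistr_bessel]

/-- The symbol `1 + ‖ξ‖ ^ 2` is unbounded, so the formula is obtained by inverting the bounded
multiplier that leads back from `bessel f` to `f`. -/
theorem fourier_bessel {d : ℕ} (f : H2Space d) : (𝓕 (bessel f) : L2Space d) =ᵐ[volume]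
    fun ξ => ((1 + ‖ξ‖ ^ 2 : ℝ) : ℂ) * (𝓕 (toL2 f) : L2Space d) ξ := by
  have h := fourier_multCLM (memLp_bessel_symbol d) (bessel f)
  rw [← toL2_eq_multCLM_bessel] at h
  filter_upwards [h] with ξ h
  rw [h, bessel_symbol_eq, mul_inv_cancel_left₀ (one_add_norm_sq_ne_zero ξ)]

theorem memSobolev_of_memLp {d : ℕ} {f : L2Space d}
    (h : MemLp (fun ξ => ((1 + ‖ξ‖ ^ 2 : ℝ) : ℂ) * (𝓕 f : L2Space d) ξ) 2) :
    TemperedDistribution.MemSobolev 2 2 (toDistr f) := by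
  refine ⟨𝓕⁻ (h.toLp _), Eq.symm ?_⟩
  change toDistr (𝓕⁻ (h.toLp _)) = _
  rw [eq_comm, ← TemperedDistribution.besselPotential_neg_apply_eq_iff,
    besselPotential_neg_toDistr]
  congr 1
  apply fourier_ext
  refine (fourier_multCLM _ _).trans ?_
  rw [FourierTransform.fourier_fourierInv_eq]
  filter_upwards [h.coeFn_toLp] with ξ h
  rw [h, bessel_symbol_eq, inv_mul_cancel_left₀ (one_add_norm_sq_ne_zero ξ)]

theorem norm_le_of_eLpNorm_le {d : ℕ} (f : H2Space d) {C : ℝ} (hC : 0 ≤ C)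
    (h : eLpNorm (fun ξ => ((1 + ‖ξ‖ ^ 2 : ℝ) : ℂ) * (𝓕 (toL2 f) : L2Space d) ξ) 2 volume
      ≤ ENNReal.ofReal C) : ‖f‖ ≤ C := by
  rw [norm_eq_norm_bessel, ← Lp.norm_fourier_eq, Lp.norm_def, eLpNorm_congr_ae (fourier_bessel f)]
  exact ENNReal.toReal_le_of_le_ofReal hC h

/-- Applying the Bessel potential of order `-2` turns the Laplacian into a bounded multiplier, which
is then divided out. The factor `(2π)²` comes from the normalisation of the Fourier transform and is
absent from the Bessel symbol. -/
theorem fourier_laplace {d : ℕ} (f : H2Space d) : (𝓕 (laplace f) : L2Space d) =ᵐ[volume]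
    fun ξ => ((-(2 * Real.pi) ^ 2 * ‖ξ‖ ^ 2 : ℝ) : ℂ) * (𝓕 (toL2 f) : L2Space d) ξ := by
  have hg : (fun ξ : EuclideanSpace ℝ (Fin d) =>
      Complex.ofReal (‖ξ‖ ^ 2 * (1 + ‖ξ‖ ^ 2) ^ (-1 : ℝ))).HasTemperateGrowth := by fun_prop
  have hb : MemLp (fun ξ : EuclideanSpace ℝ (Fin d) =>
      Complex.ofReal (‖ξ‖ ^ 2 * (1 + ‖ξ‖ ^ 2) ^ (-1 : ℝ))) ∞ := by
    refine memLp_top_of_continuous_of_bound hg.1.continuous 1 fun ξ => ?_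
    rw [Complex.norm_real, Real.norm_of_nonneg (by positivity), Real.rpow_neg_one,
      mul_inv_le_iff₀ (by positivity)]
    linarith
  have h1 : multCLM (memLp_bessel_symbol d) (laplace f) =
      (-((2 * Real.pi) ^ 2 : ℝ)) • multCLM hb (toL2 f) := by
    apply toDistr_injective
    rw [← besselPotential_neg_toDistr, toDistr_laplace,
      TemperedDistribution.besselPotential_neg_two_laplacian_eq,
      fourierMultiplierCLM_toDistr hg hb]
    exact ((toDistr (d := d)).map_smul_of_tower (-((2 * Real.pi) ^ 2 : ℝ)) _).symm
  have h2 : (𝓕 (multCLM (memLp_bessel_symbol d) (laplace f)) : L2Space d) =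
      ((-((2 * Real.pi) ^ 2 : ℝ) : ℝ) : ℂ) • (𝓕 (multCLM hb (toL2 f)) : L2Space d) := by
    rw [h1, ← FourierTransform.fourier_smul]
    rfl
  filter_upwards [fourier_multCLM (memLp_bessel_symbol d) (laplace f), fourier_multCLM hb (toL2 f),
    Lp.coeFn_smul ((-((2 * Real.pi) ^ 2 : ℝ) : ℝ) : ℂ)
      (𝓕 (multCLM hb (toL2 f)) : L2Space d)] with ξ k1 k2 k3
  rw [h2, k3, Pi.smul_apply, k2, bessel_symbol_eq, eq_inv_mul_iff_mul_eq₀ (one_add_norm_sq_ne_zero ξ)]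
    at k1
  rw [← k1, Real.rpow_neg_one, smul_eq_mul]
  have := one_add_norm_sq_ne_zero ξ
  push_cast at this ⊢
  field_simp

/-! ### The Sobolev embedding into `L^∞`. -/

/-- Both transforms can be moved onto a test function, one by its definition on distributions and
the other by Fubini, so they agree against every smooth compactly supported function. -/
theorem fourierInv_ae_eq_of_integrable {d : ℕ} {f : L2Space d} (hf : Integrable f) :
    (𝓕⁻ f : L2Space d) =ᵐ[volume] 𝓕⁻ (f : EuclideanSpace ℝ (Fin d) → ℂ) := by
  have hc : Continuous (𝓕⁻ (f : EuclideanSpace ℝ (Fin d) → ℂ)) :=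
    VectorFourier.fourierIntegral_continuous Real.continuous_fourierChar
      (L := -innerₗ (EuclideanSpace ℝ (Fin d)))
      (continuous_inner (𝕜 := ℝ) (E := EuclideanSpace ℝ (Fin d))).neg hf
  have hl : LocallyIntegrable (𝓕⁻ f : L2Space d) volume :=
    (Lp.memLp _).locallyIntegrable one_le_two
  suffices h : ∀ᵐ x, (𝓕⁻ f : L2Space d) x - 𝓕⁻ (f : EuclideanSpace ℝ (Fin d) → ℂ) x = 0 by
    filter_upwards [h] with x hx using sub_eq_zero.1 hx
  refine ae_eq_zero_of_integral_contDiff_smul_eq_zero (hl.sub hc.locallyIntegrable) ?_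
  intro g g_smooth g_cpt
  have hg₁ : HasCompactSupport (Complex.ofRealCLM ∘ g) := g_cpt.comp_left rfl
  have hg₂ : ContDiff ℝ ∞ (Complex.ofRealCLM ∘ g) := by fun_prop
  set G : 𝓢(EuclideanSpace ℝ (Fin d), ℂ) := hg₁.toSchwartzMap hg₂ with hG
  have hGg : ∀ x, G x = (g x : ℂ) := fun x => by simp [hG]
  have e1 : toDistr (𝓕⁻ f) G = toDistr f (𝓕⁻ G) := by
    rw [toDistr_fourierInv]; rfl
  rw [show toDistr (𝓕⁻ f) G = ∫ x, G x • (𝓕⁻ f : L2Space d) x from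
      Lp.toTemperedDistribution_apply _ _,
    show toDistr f (𝓕⁻ G) = ∫ x, (𝓕⁻ G) x • f x from Lp.toTemperedDistribution_apply _ _] at e1
  have e2 : ∫ x, (𝓕⁻ G) x • f x = ∫ x, G x • 𝓕⁻ (f : EuclideanSpace ℝ (Fin d) → ℂ) x := by
    have := VectorFourier.integral_fourierIntegral_smul_eq_flip (e := Real.fourierChar)
      (μ := volume) (ν := volume) (L := -innerₗ (EuclideanSpace ℝ (Fin d))) (f := G) (g := f)
      Real.continuous_fourierChar (continuous_inner (𝕜 := ℝ) (E := EuclideanSpace ℝ (Fin d))).neg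
      G.integrable hf
    rw [show (-innerₗ (EuclideanSpace ℝ (Fin d))).flip = -innerₗ (EuclideanSpace ℝ (Fin d)) by
      ext; simp [real_inner_comm]] at this
    rw [SchwartzMap.fourierInv_coe]
    exact this
  have i1 : Integrable fun x => g x • (𝓕⁻ f : L2Space d) x :=
    hl.integrable_smul_left_of_hasCompactSupport g_smooth.continuous g_cpt
  have i2 : Integrable fun x => g x • 𝓕⁻ (f : EuclideanSpace ℝ (Fin d) → ℂ) x :=
    hc.locallyIntegrable.integrable_smul_left_of_hasCompactSupport g_smooth.continuous g_cpt
  simp only [smul_sub]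
  rw [integral_sub i1 i2, sub_eq_zero]
  simpa [hGg] using e1.trans e2

/-- The Sobolev embedding `H² ⊆ L^∞` in dimension at most three. -/
theorem exists_ae_norm_le {d : ℕ} (hd : d ≤ 3) :
    ∃ C, 0 ≤ C ∧ ∀ f : H2Space d, ∀ᵐ x, ‖toL2 f x‖ ≤ C * ‖f‖ := by
  have hm : MemLp (fun ξ : EuclideanSpace ℝ (Fin d) =>
      (((1 + ‖ξ‖ ^ 2) ^ (-2 / 2 : ℝ) : ℝ) : ℂ)) 2 := by
    have hc := (memLp_bessel_symbol d).aestronglyMeasurable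
    rw [memLp_two_iff_integrable_sq_norm hc]
    -- The inverse symbol is square integrable because `d < 4`. By Cauchy–Schwarz the Fourier
    -- transform of `f` is then integrable.
    have h4 : (Module.finrank ℝ (EuclideanSpace ℝ (Fin d)) : ℝ) < 4 := by
      simp only [finrank_euclideanSpace, Fintype.card_fin]
      exact_mod_cast (by omega : d < 4)
    refine (integrable_rpow_neg_one_add_norm_sq h4).congr (Eventually.of_forall fun ξ => ?_)
    simp only
    rw [Complex.norm_real, Real.norm_of_nonneg (by positivity),
      ← Real.rpow_mul_natCast (by positivity)]
    norm_num
  set m := hm.toLp _ with hmdef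
  refine ⟨‖m‖, norm_nonneg _, fun f => ?_⟩
  set v : Lp ℂ 1 (volume : Measure (EuclideanSpace ℝ (Fin d))) := m • (𝓕 (bessel f) : L2Space d)
    with hv
  have hfv : (𝓕 (toL2 f) : L2Space d) =ᵐ[volume] v := by
    have h1 := fourier_multCLM (memLp_bessel_symbol d) (bessel f)
    rw [← toL2_eq_multCLM_bessel] at h1
    filter_upwards [h1, hm.coeFn_toLp,
      Lp.coeFn_lpSMul (r := 1) m (𝓕 (bessel f) : L2Space d)] with ξ h1 h2 h3
    rw [h1, hv, h3, Pi.smul_apply', hmdef, h2, smul_eq_mul]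
  have hvn : ‖v‖ ≤ ‖m‖ * ‖f‖ := by
    refine (Lp.norm_smul_le _ _).trans ?_
    rw [Lp.norm_fourier_eq, ← norm_eq_norm_bessel]
  have hint : Integrable (𝓕 (toL2 f) : L2Space d) :=
    (L1.integrable_coeFn v).congr hfv.symm
  have h := fourierInv_ae_eq_of_integrable hint
  rw [FourierTransform.fourierInv_fourier_eq] at h
  filter_upwards [h] with x hx
  rw [hx]
  refine (VectorFourier.norm_fourierIntegral_le_integral_norm _ _ _ _ _).trans ?_
  have e : ∫ ξ, ‖(𝓕 (toL2 f) : L2Space d) ξ‖ = ‖v‖ := by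
    rw [L1.norm_eq_integral_norm]
    exact integral_congr_ae (hfv.fun_comp norm)
  rw [e]
  exact hvn

/-! ### Second differences and their characterisation of `H²`. -/

/-- Translation by `h` on `L²`. -/
def shift {d : ℕ} (h : EuclideanSpace ℝ (Fin d)) : L2Space d →ₗᵢ[ℂ] L2Space d :=
  Lp.compMeasurePreservingₗᵢ ℂ (fun x => x + h) (measurePreserving_add_right volume h)

theorem coeFn_shift {d : ℕ} (h : EuclideanSpace ℝ (Fin d)) (f : L2Space d) :
    shift h f =ᵐ[volume] fun x => f (x + h) :=
  Lp.coeFn_compMeasurePreserving _ _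

theorem memLp_char {d : ℕ} (h : EuclideanSpace ℝ (Fin d)) :
    MemLp (fun ξ : EuclideanSpace ℝ (Fin d) => (Real.fourierChar ⟪h, ξ⟫ : ℂ)) (⊤ : ℝ≥0∞) :=
  memLp_top_of_continuous_of_bound (by
    have := Real.continuous_fourierChar
    fun_prop) 1 fun ξ => (Circle.norm_coe _).le

theorem shift_eq_multCLM {d : ℕ} (h : EuclideanSpace ℝ (Fin d)) (f : L2Space d) :
    shift h f = multCLM (memLp_char h) f := by
  refine DenseRange.induction_on (p := fun f => shift h f = multCLM (memLp_char h) f)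
    (SchwartzMap.denseRange_toLpCLM (p := 2) ENNReal.ofNat_ne_top) f
    (isClosed_eq (shift h).continuous (multCLM (memLp_char h)).continuous) fun g => ?_
  change shift h (g.toLp 2) = multCLM (memLp_char h) (g.toLp 2)
  have e : shift h (g.toLp 2) = (g.compSubConstCLM ℂ (-h)).toLp 2 := by
    apply Lp.ext
    filter_upwards [coeFn_shift h (g.toLp 2), (g.compSubConstCLM ℂ (-h)).coeFn_toLp 2 volume,
      (measurePreserving_add_right volume h).quasiMeasurePreserving.ae (g.coeFn_toLp 2 volume)]
      with x h1 h2 h3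
    rw [h1, h2, h3]
    simp
  rw [e]
  apply fourier_ext
  rw [SchwartzMap.toLp_fourier_eq]
  refine EventuallyEq.trans ?_ (fourier_multCLM _ _).symm
  rw [SchwartzMap.toLp_fourier_eq]
  filter_upwards [(𝓕 (g.compSubConstCLM ℂ (-h))).coeFn_toLp 2 volume,
    (𝓕 g).coeFn_toLp 2 volume] with ξ h1 h2
  rw [h1, h2, SchwartzMap.fourier_coe, SchwartzMap.fourier_coe]
  have := congrFun (VectorFourier.fourierIntegral_comp_add_right Real.fourierChar volume
    (innerₗ (EuclideanSpace ℝ (Fin d))) g h) ξ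
  simp only [innerₗ_apply_apply, Circle.smul_def, smul_eq_mul] at this
  rw [show (g.compSubConstCLM ℂ (-h) : EuclideanSpace ℝ (Fin d) → ℂ) = g ∘ fun v => v + h by
    ext x; simp]
  exact this

theorem norm_sq_eq_integral {d : ℕ} (f : L2Space d) : ‖f‖ ^ 2 = ∫ x, ‖f x‖ ^ 2 := by
  have h1 := inner_self_eq_norm_sq (𝕜 := ℂ) f
  rw [← h1, L2.inner_def, ← integral_re (L2.integrable_inner f f)]
  simp only [inner_self_eq_norm_sq]

/-- The symmetric second difference with step `h`, on `L²`. -/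
def secondDiff {d : ℕ} (h : EuclideanSpace ℝ (Fin d)) (f : L2Space d) : L2Space d :=
  shift h f - (2 : ℂ) • f + shift (-h) f

theorem coeFn_secondDiff {d : ℕ} (h : EuclideanSpace ℝ (Fin d)) (f : L2Space d) :
    secondDiff h f =ᵐ[volume] fun x => f (x + h) - 2 * f x + f (x - h) := by
  filter_upwards [Lp.coeFn_add (shift h f - (2 : ℂ) • f) (shift (-h) f),
    Lp.coeFn_sub (shift h f) ((2 : ℂ) • f), Lp.coeFn_smul (2 : ℂ) f, coeFn_shift h f,
    coeFn_shift (-h) f] with x h1 h2 h3 h4 h5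
  rw [secondDiff, h1, Pi.add_apply, h2, Pi.sub_apply, h3, Pi.smul_apply, h4, h5, smul_eq_mul,
    ← sub_eq_add_neg]

theorem fourierChar_second_diff (θ : ℝ) :
    (Real.fourierChar θ : ℂ) - 2 + Real.fourierChar (-θ) =
      ((-4 * Real.sin (Real.pi * θ) ^ 2 : ℝ) : ℂ) := by
  rw [Real.fourierChar_apply, Real.fourierChar_apply]
  have h1 : (2 * Real.pi * -θ : ℝ) = -(2 * Real.pi * θ) := by ring
  rw [h1]
  push_cast
  rw [sub_add_eq_add_sub, ← Complex.two_cos,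
    show (2 * Real.pi * θ : ℂ) = 2 * (Real.pi * θ) by ring, Complex.cos_two_mul, Complex.cos_sq']
  ring

theorem fourier_secondDiff {d : ℕ} (h : EuclideanSpace ℝ (Fin d)) (f : L2Space d) :
    (𝓕 (secondDiff h f) : L2Space d) =ᵐ[volume] fun ξ =>
      ((-4 * Real.sin (Real.pi * ⟪h, ξ⟫) ^ 2 : ℝ) : ℂ) * (𝓕 f : L2Space d) ξ := by
  have e : (𝓕 (secondDiff h f) : L2Space d) =
      𝓕 (multCLM (memLp_char h) f) - (2 : ℂ) • 𝓕 f + 𝓕 (multCLM (memLp_char (-h)) f) := by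
    rw [secondDiff, FourierTransform.fourier_add,
      show (𝓕 (shift h f - (2 : ℂ) • f) : L2Space d) = 𝓕 (shift h f) - 𝓕 ((2 : ℂ) • f) from
        (Lp.fourierTransformₗᵢ (EuclideanSpace ℝ (Fin d)) ℂ).map_sub _ _,
      FourierTransform.fourier_smul, shift_eq_multCLM, shift_eq_multCLM]
  rw [e]
  filter_upwards [Lp.coeFn_add (𝓕 (multCLM (memLp_char h) f) - (2 : ℂ) • 𝓕 f : L2Space d)
      (𝓕 (multCLM (memLp_char (-h)) f)),
    Lp.coeFn_sub (𝓕 (multCLM (memLp_char h) f) : L2Space d) ((2 : ℂ) • 𝓕 f),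
    Lp.coeFn_smul (2 : ℂ) (𝓕 f : L2Space d), fourier_multCLM (memLp_char h) f,
    fourier_multCLM (memLp_char (-h)) f] with x h1 h2 h3 h4 h5
  rw [h1, Pi.add_apply, h2, Pi.sub_apply, h3, Pi.smul_apply, h4, h5, smul_eq_mul,
    ← fourierChar_second_diff, inner_neg_left]
  ring

theorem norm_secondDiff_le {d : ℕ} (h : EuclideanSpace ℝ (Fin d)) (f : H2Space d) :
    ‖secondDiff h (toL2 f)‖ ≤ (4 * Real.pi ^ 2 * ‖h‖ ^ 2) * ‖f‖ := by
  rw [norm_eq_norm_bessel, ← Lp.norm_fourier_eq (bessel f), ← Lp.norm_fourier_eq]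
  refine Lp.norm_le_mul_norm_of_ae_le_mul ?_
  filter_upwards [fourier_secondDiff h (toL2 f), fourier_bessel f] with ξ h1 h2
  rw [h1, h2, norm_mul, norm_mul, ← mul_assoc, Complex.norm_real, Complex.norm_real]
  gcongr
  rw [Real.norm_of_nonneg (by positivity : (0 : ℝ) ≤ 1 + ‖ξ‖ ^ 2), norm_mul, norm_pow,
    Real.norm_eq_abs (Real.sin _)]
  have h3 : |Real.sin (Real.pi * ⟪h, ξ⟫)| ≤ Real.pi * (‖h‖ * ‖ξ‖) := by
    refine Real.abs_sin_le_abs.trans ?_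
    rw [abs_mul, abs_of_pos Real.pi_pos]
    gcongr
    exact abs_real_inner_le_norm h ξ
  calc _ ≤ ‖(-4 : ℝ)‖ * (Real.pi * (‖h‖ * ‖ξ‖)) ^ 2 := by gcongr
    _ = 4 * Real.pi ^ 2 * ‖h‖ ^ 2 * ‖ξ‖ ^ 2 := by norm_num; ring
    _ ≤ _ := by gcongr; linarith

theorem tendsto_mul_sin_div (x : ℝ) :
    Tendsto (fun n : ℕ => ((n : ℝ) + 1) * Real.sin (x / ((n : ℝ) + 1))) atTop (𝓝 x) := by
  have h : ∀ n : ℕ, ((n : ℝ) + 1) * Real.sin (x / ((n : ℝ) + 1)) =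
      x * Real.sinc (x * (1 / ((n : ℝ) + 1))) := by
    intro n
    have hn : ((n : ℝ) + 1) ≠ 0 := by positivity
    rcases eq_or_ne x 0 with rfl | hx
    · simp
    · rw [Real.sinc_of_ne_zero (by positivity), mul_one_div]
      field_simp
  simp only [h]
  have h2 := (Real.continuous_sinc.tendsto (x * 0)).comp
    ((tendsto_one_div_add_atTop_nhds_zero_nat (𝕜 := ℝ)).const_mul x)
  simpa using h2.const_mul x

/-- With step `e_j / (n + 1)`, the rescaled symbol `(n + 1)² sin²(π ξ_j / (n + 1)) / π²` tends to
`ξ_j²`, and Fatou's lemma passes the uniform bound to the limit. -/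
theorem eLpNorm_coord_sq_le {d : ℕ} {f : L2Space d} {K : ℝ} (hK : 0 ≤ K)
    (hf : ∀ h, ‖secondDiff h f‖ ≤ K * ‖h‖ ^ 2) (j : Fin d) :
    eLpNorm (fun ξ => ((ξ j ^ 2 : ℝ) : ℂ) * (𝓕 f : L2Space d) ξ) 2 volume ≤ ENNReal.ofReal K := by
  set e : ℕ → EuclideanSpace ℝ (Fin d) := fun n =>
    (1 / ((n : ℝ) + 1)) • EuclideanSpace.single j (1 : ℝ) with he
  set F : ℕ → EuclideanSpace ℝ (Fin d) → ℂ := fun n ξ =>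
    ((((n : ℝ) + 1) ^ 2 / (-4 * Real.pi ^ 2) : ℝ) : ℂ) * (𝓕 (secondDiff (e n) f) : L2Space d) ξ
    with hF
  have hlim : ∀ᵐ ξ, Tendsto (fun n => F n ξ) atTop
      (𝓝 (((ξ j ^ 2 : ℝ) : ℂ) * (𝓕 f : L2Space d) ξ)) := by
    filter_upwards [ae_all_iff.2 fun n => fourier_secondDiff (e n) f] with ξ hξ
    have hF' : ∀ n, F n ξ = ((((((n : ℝ) + 1) * Real.sin (Real.pi * ξ j / ((n : ℝ) + 1))) ^ 2) /
        Real.pi ^ 2 : ℝ) : ℂ) * (𝓕 f : L2Space d) ξ := by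
      intro n
      have hin : ⟪e n, ξ⟫ = ξ j / ((n : ℝ) + 1) := by
        rw [he, real_inner_smul_left, EuclideanSpace.inner_single_left]
        simp [div_eq_inv_mul]
      simp only [hF]
      rw [hξ n, hin, ← mul_assoc, ← Complex.ofReal_mul, mul_div_assoc]
      congr 2
      have := Real.pi_ne_zero
      field_simp
    simp only [hF']
    refine Tendsto.mul_const _ ((Complex.continuous_ofReal.tendsto _).comp ?_)
    have := ((tendsto_mul_sin_div (Real.pi * ξ j)).pow 2).div_const (Real.pi ^ 2)
    rwa [mul_pow, mul_div_cancel_left₀ _ (pow_ne_zero 2 Real.pi_ne_zero)] at this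
  refine (Lp.eLpNorm_lim_le_liminf_eLpNorm (fun n =>
    (Lp.aestronglyMeasurable _).const_mul _) _ hlim).trans ?_
  refine liminf_le_of_frequently_le' (Eventually.of_forall fun n => ?_).frequently
  have h1 : eLpNorm (F n) 2 volume =
      ENNReal.ofReal ‖((((n : ℝ) + 1) ^ 2 / (-4 * Real.pi ^ 2) : ℝ) : ℂ)‖ *
        ENNReal.ofReal ‖secondDiff (e n) f‖ := by
    rw [← Lp.norm_fourier_eq, Lp.norm_def, ENNReal.ofReal_toReal (Lp.eLpNorm_ne_top _)]
    have h0 : F n = ((((n : ℝ) + 1) ^ 2 / (-4 * Real.pi ^ 2) : ℝ) : ℂ) •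
        ((𝓕 (secondDiff (e n) f) : L2Space d) : EuclideanSpace ℝ (Fin d) → ℂ) := by
      ext ξ
      simp only [hF, Pi.smul_apply, smul_eq_mul]
    rw [h0, eLpNorm_const_smul, ofReal_norm]
  rw [h1, ← ENNReal.ofReal_mul (norm_nonneg _)]
  apply ENNReal.ofReal_le_ofReal
  have h2 : ‖e n‖ = 1 / ((n : ℝ) + 1) := by
    rw [he, norm_smul, PiLp.norm_single, norm_one, mul_one,
      Real.norm_of_nonneg (by positivity)]
  have h3 := hf (e n)
  rw [h2] at h3
  rw [Complex.norm_real, norm_div, norm_mul, norm_neg, Real.norm_of_nonneg (by positivity),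
    Real.norm_of_nonneg (by positivity : (0 : ℝ) ≤ Real.pi ^ 2), Real.norm_of_nonneg (by norm_num)]
  have hn : (0 : ℝ) < (n : ℝ) + 1 := by positivity
  have hpi : (1 : ℝ) ≤ 4 * Real.pi ^ 2 := by nlinarith [Real.pi_gt_three]
  calc _ ≤ ((n : ℝ) + 1) ^ 2 / (4 * Real.pi ^ 2) * (K * (1 / ((n : ℝ) + 1)) ^ 2) := by gcongr
    _ = K / (4 * Real.pi ^ 2) := by field_simp
    _ ≤ K := div_le_self hK hpi

/-- An `L²` function whose second differences are `O(|h|²)` in `L²` belongs to `H²`. -/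
theorem exists_H2_of_secondDiff_le {d : ℕ} {f : L2Space d} {K : ℝ} (hK : 0 ≤ K)
    (hf : ∀ h, ‖secondDiff h f‖ ≤ K * ‖h‖ ^ 2) :
    ∃ g : H2Space d, toL2 g = f ∧ ‖g‖ ≤ ‖f‖ + d * K := by
  have key : eLpNorm (fun ξ => ((1 + ‖ξ‖ ^ 2 : ℝ) : ℂ) * (𝓕 f : L2Space d) ξ) 2 volume ≤
      ENNReal.ofReal (‖f‖ + d * K) := by
    have e : (fun ξ => ((1 + ‖ξ‖ ^ 2 : ℝ) : ℂ) * (𝓕 f : L2Space d) ξ) =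
        (𝓕 f : L2Space d) + ∑ j : Fin d, fun ξ => ((ξ j ^ 2 : ℝ) : ℂ) * (𝓕 f : L2Space d) ξ := by
      ext ξ
      rw [Pi.add_apply, Finset.sum_apply, ← Finset.sum_mul, EuclideanSpace.real_norm_sq_eq]
      push_cast
      ring
    have hm : ∀ j : Fin d, AEStronglyMeasurable
        (fun ξ => ((ξ j ^ 2 : ℝ) : ℂ) * (𝓕 f : L2Space d) ξ) volume := fun j =>
      (by fun_prop : Continuous fun ξ : EuclideanSpace ℝ (Fin d) =>
        ((ξ j ^ 2 : ℝ) : ℂ)).aestronglyMeasurable.mul (Lp.aestronglyMeasurable _)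
    rw [e]
    refine (eLpNorm_add_le (Lp.aestronglyMeasurable _)
      (Finset.aestronglyMeasurable_sum _ fun j _ => hm j) one_le_two).trans ?_
    rw [ENNReal.ofReal_add (norm_nonneg _) (by positivity)]
    gcongr
    · rw [← Lp.norm_fourier_eq, Lp.norm_def, ENNReal.ofReal_toReal (Lp.eLpNorm_ne_top _)]
    · refine (eLpNorm_sum_le (fun j _ => hm j) one_le_two).trans ?_
      refine (Finset.sum_le_sum fun j _ => eLpNorm_coord_sq_le hK hf j).trans ?_
      rw [Finset.sum_const, Finset.card_univ, Fintype.card_fin, nsmul_eq_mul,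
        ENNReal.ofReal_mul (by positivity), ENNReal.ofReal_natCast]
  have hmem : MemLp (fun ξ => ((1 + ‖ξ‖ ^ 2 : ℝ) : ℂ) * (𝓕 f : L2Space d) ξ) 2 :=
    ⟨(by fun_prop : Continuous fun ξ : EuclideanSpace ℝ (Fin d) =>
      ((1 + ‖ξ‖ ^ 2 : ℝ) : ℂ)).aestronglyMeasurable.mul (Lp.aestronglyMeasurable _),
      key.trans_lt ENNReal.ofReal_lt_top⟩
  exact ⟨H2Space.mk f (memSobolev_of_memLp hmem), rfl,
    norm_le_of_eLpNorm_le _ (by positivity) key⟩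

/-! ### The nonlinearity on `H²`. -/

theorem norm_cubic_sub_le (a b : ℂ) :
    ‖((‖b‖ ^ 2 : ℝ) : ℂ) * conj b - ((‖a‖ ^ 2 : ℝ) : ℂ) * conj a‖ ≤
      3 / 2 * ‖a - b‖ * (‖a‖ ^ 2 + ‖b‖ ^ 2) := by
  have e : ((‖b‖ ^ 2 : ℝ) : ℂ) * conj b - ((‖a‖ ^ 2 : ℝ) : ℂ) * conj a =
      -(conj a * conj a * (a - b) + conj (a - b) * (conj a + conj b) * b) := by
    rw [← Complex.normSq_eq_norm_sq, ← Complex.normSq_eq_norm_sq, ← Complex.mul_conj,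
      ← Complex.mul_conj, map_sub]
    ring
  rw [e, norm_neg]
  refine (norm_add_le _ _).trans ?_
  simp only [norm_mul, RCLike.norm_conj]
  have h : ‖conj a + conj b‖ ≤ ‖a‖ + ‖b‖ := by
    refine (norm_add_le _ _).trans ?_
    simp only [RCLike.norm_conj, le_refl]
  have h2 : ‖a - b‖ * ‖conj a + conj b‖ * ‖b‖ ≤ ‖a - b‖ * (‖a‖ + ‖b‖) * ‖b‖ := by gcongr
  nlinarith [mul_nonneg (norm_nonneg (a - b)) (sq_nonneg (‖a‖ - ‖b‖))]

/-- A discrete Gagliardo–Nirenberg inequality: the `L⁴` norm of first differences of a bounded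
function is controlled by the `L²` norm of its second differences. -/
theorem integral_norm_diff_pow_four_le {d : ℕ} {u : EuclideanSpace ℝ (Fin d) → ℂ} {K : ℝ}
    (hu : MemLp u 2) (hK : ∀ᵐ x, ‖u x‖ ≤ K) (h : EuclideanSpace ℝ (Fin d)) :
    Integrable (fun x => ‖u (x + h) - u x‖ ^ 4) ∧
    ∫ x, ‖u (x + h) - u x‖ ^ 4 ≤
      9 * K ^ 2 * ∫ x, ‖u (x + h) - 2 * u x + u (x - h)‖ ^ 2 := by
  have hp := measurePreserving_add_right (volume : Measure (EuclideanSpace ℝ (Fin d))) h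
  have hm := measurePreserving_sub_right (volume : Measure (EuclideanSpace ℝ (Fin d))) h
  have hup : MemLp (fun x => u (x + h)) 2 := hu.comp_measurePreserving hp
  have hum : MemLp (fun x => u (x - h)) 2 := hu.comp_measurePreserving hm
  set D : EuclideanSpace ℝ (Fin d) → ℂ := fun x => u (x + h) - u x with hD
  have hDm : MemLp D 2 := hup.sub hu
  have hDb : ∀ᵐ x, ‖D x‖ ≤ 2 * K := by
    filter_upwards [hK, hp.quasiMeasurePreserving.ae hK] with x h1 h2
    exact (norm_sub_le _ _).trans (by linarith)
  set P : EuclideanSpace ℝ (Fin d) → ℂ := fun x => ((‖D x‖ ^ 2 : ℝ) : ℂ) * conj (D x) with hP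
  have hPm : MemLp P 2 := by
    refine MemLp.of_le_mul (c := (2 * K) ^ 2) hDm ?_ ?_
    · exact (Complex.continuous_ofReal.comp_aestronglyMeasurable (hDm.1.norm.pow 2)).mul
        (Complex.continuous_conj.comp_aestronglyMeasurable hDm.1)
    · filter_upwards [hDb] with x hx
      rw [hP, norm_mul, RCLike.norm_conj, Complex.norm_real, Real.norm_of_nonneg (by positivity)]
      gcongr
  have hPmm : MemLp (fun x => P (x - h)) 2 := hPm.comp_measurePreserving hm
  have i4 : Integrable fun x => ‖D x‖ ^ 4 := by
    have := (hPm.integrable_mul hDm).norm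
    refine this.congr (Eventually.of_forall fun x => ?_)
    simp only [Pi.mul_apply, hP, norm_mul, RCLike.norm_conj, Complex.norm_real]
    rw [Real.norm_of_nonneg (by positivity)]
    ring
  have i4m : Integrable fun x => ‖D (x - h)‖ ^ 4 := hm.integrable_comp_of_integrable i4
  have hS : MemLp (fun x => u (x + h) - 2 * u x + u (x - h)) 2 :=
    (hup.sub (hu.const_mul 2)).add hum
  have iS : Integrable fun x => ‖u (x + h) - 2 * u x + u (x - h)‖ ^ 2 :=
    (memLp_two_iff_integrable_sq_norm hS.1).1 hS
  refine ⟨i4, ?_⟩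
  have j1 : Integrable fun x => P x * u (x + h) := hPm.integrable_mul hup
  have j2 : Integrable fun x => P (x - h) * u x := hPmm.integrable_mul hu
  have jeq : ∫ x, P (x - h) * u x = ∫ x, P x * u (x + h) := by
    rw [← integral_sub_right_eq_self (fun x => P x * u (x + h)) h]
    simp only [sub_add_cancel]
  have k1 : Integrable fun x => (P x * u (x + h)).re := j1.re
  have k2 : Integrable fun x => (P (x - h) * u x).re := j2.re
  -- Summation by parts: translation invariance moves the difference from `u` to `P`, and a
  -- difference of `P` contains a second difference of `u`.
  have hT : ∫ x, ((P x * u (x + h)).re - (P (x - h) * u x).re) = 0 := by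
    have r1 : ∫ x, (P x * u (x + h)).re = (∫ x, P x * u (x + h)).re := integral_re j1
    have r2 : ∫ x, (P (x - h) * u x).re = (∫ x, P (x - h) * u x).re := integral_re j2
    rw [integral_sub k1 k2, r1, r2, jeq, sub_self]
  have hpt : ∀ᵐ x, ‖D x‖ ^ 4 ≤ ((P x * u (x + h)).re - (P (x - h) * u x).re) +
      (1 / 4 * ‖D x‖ ^ 4 + 1 / 4 * ‖D (x - h)‖ ^ 4 +
        9 / 2 * K ^ 2 * ‖u (x + h) - 2 * u x + u (x - h)‖ ^ 2) := by
    filter_upwards [hK] with x hx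
    have e1 : ‖D x‖ ^ 4 = (P x * u (x + h)).re - (P x * u x).re := by
      rw [← Complex.sub_re, ← mul_sub]
      have : P x * (u (x + h) - u x) = ((‖D x‖ ^ 4 : ℝ) : ℂ) := by
        change ((‖D x‖ ^ 2 : ℝ) : ℂ) * conj (D x) * D x = _
        rw [mul_assoc, mul_comm (conj (D x)), Complex.mul_conj, Complex.normSq_eq_norm_sq,
          ← Complex.ofReal_mul]
        congr 1
        ring
      rw [this, Complex.ofReal_re]
    have e2 : D x - D (x - h) = u (x + h) - 2 * u x + u (x - h) := by
      simp only [hD, sub_add_cancel]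
      ring
    have e3 : ((P (x - h) - P x) * u x).re ≤
        3 / 2 * ‖D x - D (x - h)‖ * (‖D x‖ ^ 2 + ‖D (x - h)‖ ^ 2) * K := by
      refine (Complex.re_le_norm _).trans ?_
      rw [norm_mul]
      gcongr
      exact norm_cubic_sub_le (D x) (D (x - h))
    rw [sub_mul, Complex.sub_re] at e3
    rw [← e2]
    set s := ‖D x - D (x - h)‖
    -- Young's inequality, weighted so that the fourth powers total one half after integration and
    -- can be absorbed on the left.
    nlinarith [sq_nonneg (3 * K * s - ‖D x‖ ^ 2), sq_nonneg (3 * K * s - ‖D (x - h)‖ ^ 2)]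
  have k3 : Integrable fun x => (P x * u (x + h)).re - (P (x - h) * u x).re := k1.sub k2
  have k4 : Integrable fun x => 1 / 4 * ‖D x‖ ^ 4 + 1 / 4 * ‖D (x - h)‖ ^ 4 :=
    (i4.const_mul _).add (i4m.const_mul _)
  have k5 : Integrable fun x => 1 / 4 * ‖D x‖ ^ 4 + 1 / 4 * ‖D (x - h)‖ ^ 4 +
      9 / 2 * K ^ 2 * ‖u (x + h) - 2 * u x + u (x - h)‖ ^ 2 := k4.add (iS.const_mul _)
  have hle := integral_mono_ae i4 (k3.add k5) hpt
  have hsh : ∫ x, ‖D (x - h)‖ ^ 4 = ∫ x, ‖D x‖ ^ 4 :=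
    integral_sub_right_eq_self (fun x => ‖D x‖ ^ 4) h
  have hsum : ∫ x, (((P x * u (x + h)).re - (P (x - h) * u x).re) +
      (1 / 4 * ‖D x‖ ^ 4 + 1 / 4 * ‖D (x - h)‖ ^ 4 +
        9 / 2 * K ^ 2 * ‖u (x + h) - 2 * u x + u (x - h)‖ ^ 2)) =
      1 / 2 * (∫ x, ‖D x‖ ^ 4) +
        9 / 2 * K ^ 2 * ∫ x, ‖u (x + h) - 2 * u x + u (x - h)‖ ^ 2 := by
    rw [integral_add k3 k5, integral_add k4 (iS.const_mul (9 / 2 * K ^ 2)), integral_add (i4.const_mul (1 / 4)) (i4m.const_mul (1 / 4)), hT, integral_const_mul,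
      integral_const_mul, integral_const_mul, hsh]
    ring
  have hle' := hle.trans_eq hsum
  linarith

/-- The pointwise bound leaves the square of a first difference, whose `L²` norm is governed by the
`L⁴` norm of that difference. The discrete Gagliardo–Nirenberg inequality returns it to the second
difference. -/
theorem exists_norm_secondDiff_powNL_le {d : ℕ} {q K : ℝ} (hq : 1 ≤ q) (hK : 0 ≤ K) :
    ∃ C, 0 ≤ C ∧ ∀ f g : L2Space d, (∀ᵐ x, ‖f x‖ ≤ K) → (∀ᵐ x, g x = powNL q (f x)) →
      ∀ h, ‖secondDiff h g‖ ≤ C * ‖secondDiff h f‖ := by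
  obtain ⟨C, hC0, hC⟩ := exists_norm_powNL_second_diff_le hq hK
  refine ⟨Real.sqrt (2 * C ^ 2 * (1 + 9 * K ^ 2)), Real.sqrt_nonneg _, fun f g hf hg h => ?_⟩
  have hp := measurePreserving_add_right (volume : Measure (EuclideanSpace ℝ (Fin d))) h
  have hm := measurePreserving_sub_right (volume : Measure (EuclideanSpace ℝ (Fin d))) h
  obtain ⟨i4, h4⟩ := integral_norm_diff_pow_four_le (Lp.memLp f) hf h
  have iS : Integrable fun x => ‖secondDiff h f x‖ ^ 2 :=
    (memLp_two_iff_integrable_sq_norm (Lp.aestronglyMeasurable _)).1 (Lp.memLp _)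
  have iG : Integrable fun x => ‖secondDiff h g x‖ ^ 2 :=
    (memLp_two_iff_integrable_sq_norm (Lp.aestronglyMeasurable _)).1 (Lp.memLp _)
  have hSf : ∫ x, ‖f (x + h) - 2 * f x + f (x - h)‖ ^ 2 = ‖secondDiff h f‖ ^ 2 := by
    rw [norm_sq_eq_integral]
    refine integral_congr_ae ?_
    filter_upwards [coeFn_secondDiff h f] with x hx
    rw [hx]
  have hpt : ∀ᵐ x, ‖secondDiff h g x‖ ^ 2 ≤
      2 * C ^ 2 * ‖secondDiff h f x‖ ^ 2 + 2 * C ^ 2 * ‖f (x + h) - f x‖ ^ 4 := by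
    filter_upwards [coeFn_secondDiff h g, coeFn_secondDiff h f, hf, hg,
      hp.quasiMeasurePreserving.ae hf, hp.quasiMeasurePreserving.ae hg,
      hm.quasiMeasurePreserving.ae hf, hm.quasiMeasurePreserving.ae hg] with x a1 a2 b1 b2 c1 c2 d1 d2
    rw [a1, a2, b2, c2, d2]
    have := hC _ _ _ c1 b1 d1
    calc _ ≤ (C * (‖f (x + h) - 2 * f x + f (x - h)‖ + ‖f (x + h) - f x‖ ^ 2)) ^ 2 := by gcongr
      _ ≤ _ := by
        have := mul_nonneg (sq_nonneg C)
          (sq_nonneg (‖f (x + h) - 2 * f x + f (x - h)‖ - ‖f (x + h) - f x‖ ^ 2))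
        nlinarith
  have hle := integral_mono_ae iG ((iS.const_mul (2 * C ^ 2)).add (i4.const_mul (2 * C ^ 2))) hpt
  have hsum : ∫ x, (2 * C ^ 2 * ‖secondDiff h f x‖ ^ 2 + 2 * C ^ 2 * ‖f (x + h) - f x‖ ^ 4) =
      2 * C ^ 2 * ‖secondDiff h f‖ ^ 2 + 2 * C ^ 2 * ∫ x, ‖f (x + h) - f x‖ ^ 4 := by
    rw [integral_add (iS.const_mul _) (i4.const_mul _), integral_const_mul, integral_const_mul,
      ← norm_sq_eq_integral]
  have hle' := hle.trans_eq hsum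
  rw [← norm_sq_eq_integral] at hle'
  rw [hSf] at h4
  refine le_of_sq_le_sq ?_ (by positivity)
  rw [mul_pow, Real.sq_sqrt (by positivity)]
  nlinarith [mul_le_mul_of_nonneg_left h4 (by positivity : 0 ≤ 2 * C ^ 2)]

theorem memLp_powNL {d : ℕ} {q K : ℝ} (hq : 0 ≤ q) {f : L2Space d} (hf : ∀ᵐ x, ‖f x‖ ≤ K) :
    MemLp (fun x => powNL q (f x)) 2 := by
  refine MemLp.of_le_mul (c := K ^ q) (Lp.memLp f)
    ((continuous_powNL hq).comp_aestronglyMeasurable (Lp.aestronglyMeasurable f)) ?_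
  filter_upwards [hf] with x hx
  rw [norm_powNL]
  gcongr

open Classical in
/-- The nonlinearity `|f|^q f` on `L²`, set to zero where it does not take values in `L²`. -/
def nonlin {d : ℕ} (q : ℝ) (f : L2Space d) : L2Space d :=
  if h : MemLp (fun x => powNL q (f x)) 2 volume then h.toLp _ else 0

theorem coeFn_nonlin {d : ℕ} {q K : ℝ} (hq : 0 ≤ q) {f : L2Space d} (hf : ∀ᵐ x, ‖f x‖ ≤ K) :
    nonlin q f =ᵐ[volume] fun x => powNL q (f x) := by
  rw [nonlin, dif_pos (memLp_powNL hq hf)]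
  exact MemLp.coeFn_toLp _

theorem nonlin_eq_compLp {d : ℕ} {q K : ℝ} (hq : 1 ≤ q) (hK : 0 ≤ K) {f : L2Space d}
    (hf : ∀ᵐ x, ‖f x‖ ≤ K) :
    nonlin q f = (lipschitzWith_cutNL hq hK).compLp (cutNL_zero q K) f := by
  apply Lp.ext
  filter_upwards [coeFn_nonlin (q := q) (by linarith) hf, hf,
    (lipschitzWith_cutNL hq hK).coeFn_compLp (cutNL_zero q K) f] with x h1 h2 h3
  rw [h1, h3, Function.comp_apply, cutNL_eq_powNL h2]

theorem norm_toL2_le {d : ℕ} (f : H2Space d) : ‖toL2 f‖ ≤ ‖f‖ := by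
  rw [norm_eq_norm_bessel, ← Lp.norm_fourier_eq, ← Lp.norm_fourier_eq (bessel f)]
  refine Lp.norm_le_norm_of_ae_le ?_
  filter_upwards [fourier_bessel f] with ξ h
  rw [h, norm_mul, Complex.norm_real, Real.norm_of_nonneg (by positivity)]
  nlinarith [mul_nonneg (sq_nonneg ‖ξ‖) (norm_nonneg ((𝓕 (toL2 f) : L2Space d) ξ))]

/-- The `H²` ball is bounded in `L^∞`, so a cut-off at that bound does not change the nonlinearity
there. -/
theorem exists_lipschitz_eq_nonlin {d : ℕ} (hd : d ≤ 3) {q : ℝ} (hq : 1 ≤ q) (R : ℝ) :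
    ∃ (G : L2Space d → L2Space d) (L : ℝ≥0), LipschitzWith L G ∧
      ∀ f : H2Space d, ‖f‖ ≤ R → nonlin q (toL2 f) = G (toL2 f) := by
  obtain ⟨C, hC, h⟩ := exists_ae_norm_le hd
  have hK : 0 ≤ C * max R 0 := by positivity
  refine ⟨_, _, (lipschitzWith_cutNL hq hK).lipschitzWith_compLp (cutNL_zero q _), fun f hf => ?_⟩
  refine nonlin_eq_compLp hq hK ?_
  filter_upwards [h f] with x hx
  exact hx.trans (by gcongr; exact hf.trans (le_max_left _ _))

/-- The power nonlinearity maps bounded sets of `H²` to bounded sets of `H²`. -/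
theorem exists_nonlin_H2_bound {d : ℕ} (hd : d ≤ 3) {q : ℝ} (hq : 1 ≤ q) (R : ℝ) :
    ∃ C, 0 ≤ C ∧ ∀ f : H2Space d, ‖f‖ ≤ R →
      ∃ g : H2Space d, toL2 g = nonlin q (toL2 f) ∧ ‖g‖ ≤ C := by
  obtain ⟨S, hS, h⟩ := exists_ae_norm_le hd
  set K := S * max R 0 with hKdef
  have hK : 0 ≤ K := by positivity
  obtain ⟨C, hC0, hC⟩ := exists_norm_secondDiff_powNL_le (d := d) hq hK
  refine ⟨K ^ q * max R 0 + d * (C * (4 * Real.pi ^ 2) * max R 0), by positivity, fun f hf => ?_⟩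
  have hfR : ‖f‖ ≤ max R 0 := hf.trans (le_max_left _ _)
  have hfK : ∀ᵐ x, ‖toL2 f x‖ ≤ K := by
    filter_upwards [h f] with x hx
    exact hx.trans (mul_le_mul_of_nonneg_left hfR hS)
  have hn := coeFn_nonlin (q := q) (by linarith) hfK
  obtain ⟨g, hg, hgn⟩ := exists_H2_of_secondDiff_le (f := nonlin q (toL2 f))
    (K := C * (4 * Real.pi ^ 2) * max R 0) (by positivity) fun h => by
      refine (hC _ _ hfK hn h).trans ?_
      calc _ ≤ C * ((4 * Real.pi ^ 2 * ‖h‖ ^ 2) * max R 0) := by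
            gcongr
            exact (norm_secondDiff_le h f).trans (by gcongr)
        _ = _ := by ring
  refine ⟨g, hg, hgn.trans ?_⟩
  gcongr
  have : ‖nonlin q (toL2 f)‖ ≤ K ^ q * ‖toL2 f‖ := by
    refine Lp.norm_le_mul_norm_of_ae_le_mul ?_
    filter_upwards [hn, hfK] with x h1 h2
    rw [h1, norm_powNL]
    gcongr
  exact this.trans (by gcongr; exact (norm_toL2_le f).trans hfR)

/-! ### The free Schrödinger propagator. -/

/-- The symbol `exp(-4π² i a |ξ|²)` of the free Schrödinger propagator. -/
def phaseSymbol {d : ℕ} (a : ℝ) (ξ : EuclideanSpace ℝ (Fin d)) : ℂ :=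
  Complex.exp (Complex.I * ((-(a * ((2 * Real.pi) ^ 2 * ‖ξ‖ ^ 2)) : ℝ) : ℂ))

theorem norm_phaseSymbol {d : ℕ} (a : ℝ) (ξ : EuclideanSpace ℝ (Fin d)) :
    ‖phaseSymbol a ξ‖ = 1 := by
  rw [phaseSymbol, mul_comm, Complex.norm_exp_ofReal_mul_I]

theorem phaseSymbol_add {d : ℕ} (a b : ℝ) (ξ : EuclideanSpace ℝ (Fin d)) :
    phaseSymbol (a + b) ξ = phaseSymbol a ξ * phaseSymbol b ξ := by
  simp only [phaseSymbol, ← Complex.exp_add]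
  congr 1
  push_cast
  ring

theorem phaseSymbol_zero {d : ℕ} (ξ : EuclideanSpace ℝ (Fin d)) : phaseSymbol 0 ξ = 1 := by
  simp [phaseSymbol]

theorem memLp_phaseSymbol {d : ℕ} (a : ℝ) :
    MemLp (phaseSymbol a : EuclideanSpace ℝ (Fin d) → ℂ) ∞ :=
  memLp_top_of_continuous_of_bound (by unfold phaseSymbol; fun_prop) 1 fun ξ => (norm_phaseSymbol a ξ).le

theorem hasDerivAt_phaseSymbol {d : ℕ} (a : ℝ) (ξ : EuclideanSpace ℝ (Fin d)) :
    HasDerivAt (fun s => phaseSymbol s ξ)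
      (Complex.I * ((-(2 * Real.pi) ^ 2 * ‖ξ‖ ^ 2 : ℝ) : ℂ) * phaseSymbol a ξ) a := by
  have h1 : HasDerivAt (fun s : ℝ => -(s * ((2 * Real.pi) ^ 2 * ‖ξ‖ ^ 2)))
      (-(1 * ((2 * Real.pi) ^ 2 * ‖ξ‖ ^ 2))) a := ((hasDerivAt_id a).mul_const _).neg
  have h2 := (h1.ofReal_comp.const_mul Complex.I).cexp
  convert! h2 using 1
  rw [phaseSymbol]
  push_cast
  ring

theorem norm_phaseSymbol_sub_le {d : ℕ} (s a : ℝ) (ξ : EuclideanSpace ℝ (Fin d)) :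
    ‖phaseSymbol s ξ - phaseSymbol a ξ‖ ≤ |s - a| * ((2 * Real.pi) ^ 2 * ‖ξ‖ ^ 2) := by
  have e : phaseSymbol s ξ - phaseSymbol a ξ = (phaseSymbol (s - a) ξ - 1) * phaseSymbol a ξ := by
    rw [sub_mul, ← phaseSymbol_add, sub_add_cancel, one_mul]
  rw [e, norm_mul, norm_phaseSymbol, mul_one]
  refine (Real.norm_exp_I_mul_ofReal_sub_one_le).trans ?_
  rw [norm_neg, norm_mul, Real.norm_eq_abs, Real.norm_of_nonneg (by positivity)]

/-- The free Schrödinger propagator `exp(i a Δ)` on `L²`. -/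
def schro {d : ℕ} (a : ℝ) : L2Space d →L[ℂ] L2Space d := multCLM (memLp_phaseSymbol a)

theorem fourier_schro {d : ℕ} (a : ℝ) (f : L2Space d) : (𝓕 (schro a f) : L2Space d) =ᵐ[volume]
    fun ξ => phaseSymbol a ξ * (𝓕 f : L2Space d) ξ := fourier_multCLM _ f

theorem schro_schro {d : ℕ} (a b : ℝ) (f : L2Space d) :
    schro a (schro b f) = schro (a + b) f := by
  apply fourier_ext
  filter_upwards [fourier_schro a (schro b f), fourier_schro b f, fourier_schro (a + b) f]
    with ξ h1 h2 h3
  rw [h1, h2, h3, phaseSymbol_add, mul_assoc]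

theorem schro_zero {d : ℕ} (f : L2Space d) : schro 0 f = f := by
  apply fourier_ext
  filter_upwards [fourier_schro 0 f] with ξ h
  rw [h, phaseSymbol_zero, one_mul]

theorem schro_neg_schro {d : ℕ} (a : ℝ) (f : L2Space d) : schro (-a) (schro a f) = f := by
  rw [schro_schro, neg_add_cancel, schro_zero]

theorem schro_schro_neg {d : ℕ} (a : ℝ) (f : L2Space d) : schro a (schro (-a) f) = f := by
  rw [schro_schro, add_neg_cancel, schro_zero]

theorem norm_schro {d : ℕ} (a : ℝ) (f : L2Space d) : ‖schro a f‖ = ‖f‖ := by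
  rw [← Lp.norm_fourier_eq, ← Lp.norm_fourier_eq f, Lp.norm_def, Lp.norm_def]
  congr 1
  refine eLpNorm_congr_norm_ae ?_
  filter_upwards [fourier_schro a f] with ξ h
  rw [h, norm_mul, norm_phaseSymbol, one_mul]

/-- Dominated convergence combined with Plancherel; `B` is a majorant on the Fourier side. -/
theorem tendsto_of_fourier_dominated {d : ℕ} {ι : Type*} {l : Filter ι} [l.IsCountablyGenerated]
    {F : ι → L2Space d} {g B : L2Space d} {R : ι → EuclideanSpace ℝ (Fin d) → ℂ}
    (hR : ∀ i, (𝓕 (F i - g) : L2Space d) =ᵐ[volume] R i)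
    (hB : ∀ᶠ i in l, ∀ᵐ x, ‖R i x‖ ≤ ‖B x‖) (hlim : ∀ᵐ x, Tendsto (fun i => R i x) l (𝓝 0)) :
    Tendsto F l (𝓝 g) := by
  rw [tendsto_iff_norm_sub_tendsto_zero]
  have h1 : ∀ i, ‖F i - g‖ ^ 2 = ∫ x, ‖R i x‖ ^ 2 := by
    intro i
    rw [← Lp.norm_fourier_eq, norm_sq_eq_integral]
    refine integral_congr_ae ?_
    filter_upwards [hR i] with x hx
    rw [hx]
  have h2 : Tendsto (fun i => ∫ x, ‖R i x‖ ^ 2) l (𝓝 (∫ _ : EuclideanSpace ℝ (Fin d), (0 : ℝ))) := by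
    refine tendsto_integral_filter_of_dominated_convergence (fun x => ‖B x‖ ^ 2)
      (Eventually.of_forall fun i =>
        (((Lp.aestronglyMeasurable _).congr (hR i)).norm.pow 2)) ?_
      ((memLp_two_iff_integrable_sq_norm (Lp.aestronglyMeasurable _)).1 (Lp.memLp B)) ?_
    · filter_upwards [hB] with i hi
      filter_upwards [hi] with x hx
      rw [norm_pow, norm_norm]
      gcongr
    · filter_upwards [hlim] with x hx
      simpa using (hx.norm.pow 2)
  rw [integral_zero] at h2
  simp only [← h1] at h2
  have h3 := h2.sqrt
  simpa using h3

theorem continuous_schro {d : ℕ} (f : L2Space d) : Continuous fun a => schro a f := by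
  rw [continuous_iff_continuousAt]
  intro a
  refine tendsto_of_fourier_dominated (B := (2 : ℂ) • 𝓕 f)
    (R := fun s ξ => (phaseSymbol s ξ - phaseSymbol a ξ) * (𝓕 f : L2Space d) ξ) ?_ ?_ ?_
  · intro s
    rw [show (𝓕 (schro s f - schro a f) : L2Space d) = 𝓕 (schro s f) - 𝓕 (schro a f) from
      (Lp.fourierTransformₗᵢ (EuclideanSpace ℝ (Fin d)) ℂ).map_sub _ _]
    filter_upwards [Lp.coeFn_sub (𝓕 (schro s f) : L2Space d) (𝓕 (schro a f)), fourier_schro s f,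
      fourier_schro a f] with ξ h1 h2 h3
    rw [h1, Pi.sub_apply, h2, h3, sub_mul]
  · refine Eventually.of_forall fun s => ?_
    filter_upwards [Lp.coeFn_smul (2 : ℂ) (𝓕 f : L2Space d)] with ξ h
    rw [h, Pi.smul_apply, smul_eq_mul, norm_mul, norm_mul]
    gcongr
    refine (norm_sub_le _ _).trans ?_
    rw [norm_phaseSymbol, norm_phaseSymbol]
    norm_num
  · refine Eventually.of_forall fun ξ => ?_
    have := (((hasDerivAt_phaseSymbol a ξ).continuousAt.tendsto.sub_const (phaseSymbol a ξ)).mul_const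
      ((𝓕 f : L2Space d) ξ))
    simpa using this

/-- Strong continuity in `a` becomes joint continuity because every `schro a` is isometric. -/
theorem tendsto_schro {d : ℕ} {ι : Type*} {l : Filter ι} {a : ι → ℝ} {a₀ : ℝ} {f : ι → L2Space d}
    {f₀ : L2Space d} (ha : Tendsto a l (𝓝 a₀)) (hf : Tendsto f l (𝓝 f₀)) :
    Tendsto (fun i => schro (a i) (f i)) l (𝓝 (schro a₀ f₀)) := by
  have h1 : Tendsto (fun i => schro (a i) (f i - f₀)) l (𝓝 0) := by
    rw [tendsto_zero_iff_norm_tendsto_zero]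
    simp only [norm_schro]
    exact tendsto_iff_norm_sub_tendsto_zero.1 hf
  have h2 := h1.add (((continuous_schro f₀).tendsto a₀).comp ha)
  simpa using h2

theorem hasDerivAt_schro {d : ℕ} (a : ℝ) (f : H2Space d) :
    HasDerivAt (fun s => schro s (toL2 f)) (Complex.I • schro a (laplace f)) a := by
  rw [hasDerivAt_iff_tendsto_slope]
  refine tendsto_of_fourier_dominated (B := (2 : ℂ) • 𝓕 (laplace f))
    (R := fun s ξ => (slope (fun s => phaseSymbol s ξ) a s -
      Complex.I * ((-(2 * Real.pi) ^ 2 * ‖ξ‖ ^ 2 : ℝ) : ℂ) * phaseSymbol a ξ) *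
        (𝓕 (toL2 f) : L2Space d) ξ) ?_ ?_ ?_
  · intro s
    have e : (𝓕 (slope (fun s => schro s (toL2 f)) a s - Complex.I • schro a (laplace f)) :
        L2Space d) = (((s - a)⁻¹ : ℝ) : ℂ) • (𝓕 (schro s (toL2 f)) - 𝓕 (schro a (toL2 f))) -
          Complex.I • 𝓕 (schro a (laplace f)) := by
      have e1 : slope (fun s => schro s (toL2 f)) a s =
          (((s - a)⁻¹ : ℝ) : ℂ) • (schro s (toL2 f) - schro a (toL2 f)) := by
        rw [slope_def_module]; rfl
      rw [e1]
      change Lp.fourierTransformₗᵢ (EuclideanSpace ℝ (Fin d)) ℂ _ = _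
      simp only [map_sub, map_smul]
      rfl
    rw [e]
    filter_upwards [fourier_schro s (toL2 f), fourier_schro a (toL2 f),
      fourier_schro a (laplace f), fourier_laplace f,
      Lp.coeFn_sub (𝓕 (schro s (toL2 f)) : L2Space d) (𝓕 (schro a (toL2 f))),
      Lp.coeFn_smul (((s - a)⁻¹ : ℝ) : ℂ)
        (𝓕 (schro s (toL2 f)) - 𝓕 (schro a (toL2 f)) : L2Space d),
      Lp.coeFn_smul Complex.I (𝓕 (schro a (laplace f)) : L2Space d),
      Lp.coeFn_sub ((((s - a)⁻¹ : ℝ) : ℂ) •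
        (𝓕 (schro s (toL2 f)) - 𝓕 (schro a (toL2 f)) : L2Space d))
        (Complex.I • 𝓕 (schro a (laplace f)))] with ξ h1 h2 h3 h4 h5 h6 h7 h8
    rw [h8, Pi.sub_apply, h6, Pi.smul_apply, h5, Pi.sub_apply, h7, Pi.smul_apply, h1, h2, h3, h4,
      slope_def_module, Complex.real_smul]
    simp only [smul_eq_mul]
    ring
  · refine Eventually.of_forall fun s => ?_
    filter_upwards [Lp.coeFn_smul (2 : ℂ) (𝓕 (laplace f) : L2Space d), fourier_laplace f]
      with ξ h h'
    rw [h, Pi.smul_apply, smul_eq_mul, h', norm_mul, norm_mul, norm_mul, ← mul_assoc]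
    gcongr
    have b1 : ‖slope (fun s => phaseSymbol s ξ) a s‖ ≤ (2 * Real.pi) ^ 2 * ‖ξ‖ ^ 2 := by
      rw [slope_def_module, norm_smul, norm_inv, Real.norm_eq_abs]
      rcases eq_or_ne s a with rfl | hs
      · simp; positivity
      · rw [inv_mul_le_iff₀ (abs_pos.2 (sub_ne_zero.2 hs))]
        exact norm_phaseSymbol_sub_le s a ξ
    have b2 : ‖((-(2 * Real.pi) ^ 2 * ‖ξ‖ ^ 2 : ℝ) : ℂ)‖ = (2 * Real.pi) ^ 2 * ‖ξ‖ ^ 2 := by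
      rw [Complex.norm_real, neg_mul, norm_neg, Real.norm_of_nonneg (by positivity)]
    refine (norm_sub_le _ _).trans ?_
    rw [norm_mul, norm_mul, norm_phaseSymbol, Complex.norm_I, b2, Complex.norm_ofNat]
    linarith
  · refine Eventually.of_forall fun ξ => ?_
    have := ((hasDerivAt_iff_tendsto_slope.1 (hasDerivAt_phaseSymbol a ξ)).sub_const
      (Complex.I * ((-(2 * Real.pi) ^ 2 * ‖ξ‖ ^ 2 : ℝ) : ℂ) * phaseSymbol a ξ)).mul_const
        ((𝓕 (toL2 f) : L2Space d) ξ)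
    rwa [sub_self, zero_mul] at this

/-- The increment `z s - z t` needs only strong continuity of the propagator. Hence `H²` regularity
is needed only for the frozen value `z t`, not for `z` near `t`. -/
theorem HasDerivAt.schro_apply {d : ℕ} {a : ℝ → ℝ} {z : ℝ → L2Space d} {a' t : ℝ}
    {z' : L2Space d} {f : H2Space d} (ha : HasDerivAt a a' t) (hz : HasDerivAt z z' t)
    (hf : z t = toL2 f) :
    HasDerivAt (fun s => schro (a s) (z s))
      (schro (a t) z' + (a' : ℂ) • Complex.I • schro (a t) (laplace f)) t := by
  have h1 : HasDerivAt (fun s => schro (a s) (z s - z t)) (schro (a t) z') t := by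
    rw [hasDerivAt_iff_tendsto_slope]
    have h := tendsto_schro (ha.continuousAt.tendsto.mono_left nhdsWithin_le_nhds)
      (hasDerivAt_iff_tendsto_slope.1 hz)
    refine h.congr fun s => ?_
    rw [slope_def_module, slope_def_module, sub_self, map_zero, sub_zero]
    exact (schro (a s)).map_smul_of_tower (s - t)⁻¹ (z s - z t)
  have h2 : HasDerivAt (fun s => schro (a s) (z t))
      ((a' : ℂ) • Complex.I • schro (a t) (laplace f)) t := by
    rw [hf]
    exact (hasDerivAt_schro (a t) f).scomp t ha
  refine (h1.add h2).congr_of_eventuallyEq (Eventually.of_forall fun s => ?_)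
  simp

/-- The free Schrödinger propagator preserves `H²` and commutes with the Bessel potential. -/
theorem exists_schro_H2 {d : ℕ} (a : ℝ) (f : H2Space d) :
    ∃ g : H2Space d, toL2 g = schro a (toL2 f) ∧ bessel g = schro a (bessel f) := by
  have hm : (𝓕 (schro a (bessel f)) : L2Space d) =ᵐ[volume]
      fun ξ => ((1 + ‖ξ‖ ^ 2 : ℝ) : ℂ) * (𝓕 (schro a (toL2 f)) : L2Space d) ξ := by
    filter_upwards [fourier_schro a (bessel f), fourier_bessel f, fourier_schro a (toL2 f)]
      with ξ h1 h2 h3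
    rw [h1, h2, h3]
    ring
  refine ⟨H2Space.mk _ (memSobolev_of_memLp ((Lp.memLp _).ae_eq hm)), rfl, ?_⟩
  apply fourier_ext
  refine (fourier_bessel _).trans ?_
  rw [toL2_mk]
  exact hm.symm

/-- The free Schrödinger propagator `exp(i a Δ)` on `H²`. -/
def schroH2 {d : ℕ} (a : ℝ) (f : H2Space d) : H2Space d := (exists_schro_H2 a f).choose

theorem toL2_schroH2 {d : ℕ} (a : ℝ) (f : H2Space d) : toL2 (schroH2 a f) = schro a (toL2 f) :=
  (exists_schro_H2 a f).choose_spec.1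

theorem bessel_schroH2 {d : ℕ} (a : ℝ) (f : H2Space d) :
    bessel (schroH2 a f) = schro a (bessel f) := (exists_schro_H2 a f).choose_spec.2

theorem norm_schroH2 {d : ℕ} (a : ℝ) (f : H2Space d) : ‖schroH2 a f‖ = ‖f‖ := by
  rw [norm_eq_norm_bessel, bessel_schroH2, norm_schro, norm_eq_norm_bessel]

theorem tendsto_schroH2 {d : ℕ} {ι : Type*} {l : Filter ι} {a : ι → ℝ} {a₀ : ℝ}
    {f : ι → H2Space d} {f₀ : H2Space d} (ha : Tendsto a l (𝓝 a₀)) (hf : Tendsto f l (𝓝 f₀)) :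
    Tendsto (fun i => schroH2 (a i) (f i)) l (𝓝 (schroH2 a₀ f₀)) := by
  have hb : ∀ u v : H2Space d, ‖u - v‖ = ‖bessel u - bessel v‖ := fun u v => by
    rw [norm_eq_norm_bessel, map_sub]
  rw [tendsto_iff_norm_sub_tendsto_zero] at hf ⊢
  simp only [hb, bessel_schroH2] at hf ⊢
  rw [← tendsto_iff_norm_sub_tendsto_zero] at hf ⊢
  exact tendsto_schro ha hf

theorem laplace_schroH2 {d : ℕ} (a : ℝ) (f : H2Space d) :
    laplace (schroH2 a f) = schro a (laplace f) := by
  apply fourier_ext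
  filter_upwards [fourier_laplace (schroH2 a f), fourier_schro a (laplace f), fourier_laplace f,
    fourier_schro a (toL2 f)] with ξ h1 h2 h3 h4
  rw [h1, h2, h3, toL2_schroH2, h4]
  ring

/-! ### Balls of `H²` inside `L²`. -/

/-- The closed ball of radius `R` of `H²`, as a subset of `L²`. -/
def H2Ball (d : ℕ) (R : ℝ) : Set (L2Space d) := {f | ∃ g : H2Space d, toL2 g = f ∧ ‖g‖ ≤ R}

theorem memLp_truncated_symbol (d n : ℕ) : MemLp
    (fun ξ : EuclideanSpace ℝ (Fin d) => ((min (1 + ‖ξ‖ ^ 2) (n : ℝ) : ℝ) : ℂ)) ∞ := by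
  refine memLp_top_of_continuous_of_bound (by fun_prop) n fun ξ => ?_
  rw [Complex.norm_real, Real.norm_of_nonneg (by positivity)]
  exact min_le_right _ _

/-- The `H²` norm is the supremum of the norms of bounded multipliers with truncated symbols. This
makes the ball an intersection of `L²`-closed sets and lets the `H²` bound pass through integrals
taken in `L²`. -/
theorem mem_H2Ball_iff {d : ℕ} {R : ℝ} (hR : 0 ≤ R) (f : L2Space d) :
    f ∈ H2Ball d R ↔ ∀ n : ℕ, ‖multCLM (memLp_truncated_symbol d n) f‖ ≤ R := by
  constructor
  · rintro ⟨g, rfl, hg⟩ n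
    refine le_trans ?_ hg
    rw [norm_eq_norm_bessel, ← Lp.norm_fourier_eq, ← Lp.norm_fourier_eq (bessel g)]
    refine Lp.norm_le_norm_of_ae_le ?_
    filter_upwards [fourier_multCLM (memLp_truncated_symbol d n) (toL2 g), fourier_bessel g]
      with ξ h1 h2
    rw [h1, h2, norm_mul, norm_mul, Complex.norm_real, Complex.norm_real,
      Real.norm_of_nonneg (by positivity), Real.norm_of_nonneg (by positivity)]
    gcongr
    exact min_le_left _ _
  · intro h
    have key : eLpNorm (fun ξ => ((1 + ‖ξ‖ ^ 2 : ℝ) : ℂ) * (𝓕 f : L2Space d) ξ) 2 volume ≤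
        ENNReal.ofReal R := by
      have hlim : ∀ᵐ ξ, Tendsto
          (fun n : ℕ => (𝓕 (multCLM (memLp_truncated_symbol d n) f) : L2Space d) ξ) atTop
          (𝓝 (((1 + ‖ξ‖ ^ 2 : ℝ) : ℂ) * (𝓕 f : L2Space d) ξ)) := by
        filter_upwards [ae_all_iff.2 fun n => fourier_multCLM (memLp_truncated_symbol d n) f]
          with ξ hξ
        refine tendsto_const_nhds.congr' ?_
        filter_upwards [eventually_ge_atTop ⌈1 + ‖ξ‖ ^ 2⌉₊] with n hn
        rw [hξ n, min_eq_left ((Nat.le_ceil _).trans (Nat.cast_le.2 hn))]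
      refine (Lp.eLpNorm_lim_le_liminf_eLpNorm (fun n => Lp.aestronglyMeasurable _) _ hlim).trans ?_
      refine liminf_le_of_frequently_le' (Eventually.of_forall fun n => ?_).frequently
      rw [← ENNReal.ofReal_toReal (Lp.eLpNorm_ne_top _), ← Lp.norm_def, Lp.norm_fourier_eq]
      exact ENNReal.ofReal_le_ofReal (h n)
    have hmem : MemLp (fun ξ => ((1 + ‖ξ‖ ^ 2 : ℝ) : ℂ) * (𝓕 f : L2Space d) ξ) 2 :=
      ⟨(by fun_prop : Continuous fun ξ : EuclideanSpace ℝ (Fin d) =>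
        ((1 + ‖ξ‖ ^ 2 : ℝ) : ℂ)).aestronglyMeasurable.mul (Lp.aestronglyMeasurable _),
        key.trans_lt ENNReal.ofReal_lt_top⟩
    exact ⟨H2Space.mk f (memSobolev_of_memLp hmem), rfl, norm_le_of_eLpNorm_le _ hR key⟩

theorem isClosed_H2Ball {d : ℕ} {R : ℝ} (hR : 0 ≤ R) : IsClosed (H2Ball d R) := by
  have : H2Ball d R = ⋂ n : ℕ, {f | ‖multCLM (memLp_truncated_symbol d n) f‖ ≤ R} := by
    ext f
    rw [mem_H2Ball_iff hR, mem_iInter]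
    rfl
  rw [this]
  exact isClosed_iInter fun n =>
    isClosed_le (multCLM (memLp_truncated_symbol d n)).continuous.norm continuous_const

theorem H2Ball_mono {d : ℕ} {R R' : ℝ} (h : R ≤ R') : H2Ball d R ⊆ H2Ball d R' :=
  fun _ ⟨g, hg, hR⟩ => ⟨g, hg, hR.trans h⟩

theorem add_mem_H2Ball {d : ℕ} {R R' : ℝ} {f f' : L2Space d} (hf : f ∈ H2Ball d R)
    (hf' : f' ∈ H2Ball d R') : f + f' ∈ H2Ball d (R + R') := by
  obtain ⟨g, rfl, hg⟩ := hf
  obtain ⟨g', rfl, hg'⟩ := hf'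
  exact ⟨g + g', map_add _ _ _, (norm_add_le _ _).trans (add_le_add hg hg')⟩

theorem schro_mem_H2Ball {d : ℕ} {R : ℝ} {f : L2Space d} (a : ℝ) (hf : f ∈ H2Ball d R) :
    schro a f ∈ H2Ball d R := by
  obtain ⟨g, rfl, hg⟩ := hf
  exact ⟨schroH2 a g, toL2_schroH2 a g, (norm_schroH2 a g).trans_le hg⟩

theorem I_smul_mem_H2Ball {d : ℕ} {R : ℝ} {f : L2Space d} (hf : f ∈ H2Ball d R) :
    Complex.I • f ∈ H2Ball d R := by
  obtain ⟨g, rfl, hg⟩ := hf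
  exact ⟨Complex.I • g, map_smul _ _ _, by rwa [norm_smul, Complex.norm_I, one_mul]⟩

/-- Integrability is required only in `L²`: each truncated multiplier is continuous there and
commutes with the integral. -/
theorem integral_mem_H2Ball {d : ℕ} {C s t : ℝ} {F : ℝ → L2Space d} (hC : 0 ≤ C) (hst : s ≤ t)
    (hF : IntervalIntegrable F volume s t) (h : ∀ r ∈ Icc s t, F r ∈ H2Ball d C) :
    ∫ r in s..t, F r ∈ H2Ball d (C * (t - s)) := by
  rw [mem_H2Ball_iff (mul_nonneg hC (sub_nonneg.2 hst))]
  intro n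
  rw [← ContinuousLinearMap.intervalIntegral_comp_comm _ hF, ← abs_of_nonneg (sub_nonneg.2 hst)]
  refine intervalIntegral.norm_integral_le_of_norm_le_const fun r hr => ?_
  rw [uIoc_of_le hst] at hr
  exact (mem_H2Ball_iff hC _).1 (h r (Ioc_subset_Icc_self hr)) n

theorem continuous_toL2 {d : ℕ} : Continuous (toL2 (d := d)) :=
  AddMonoidHomClass.continuous_of_bound (toL2 (d := d)) 1 fun f => by
    rw [one_mul]; exact norm_toL2_le f

/-! ### Local existence in the interaction picture. -/

/-- The vector field of the equation in the interaction picture. -/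
def field {d : ℕ} (a : ℝ → ℝ) (G : L2Space d → L2Space d) (s : ℝ) (z : L2Space d) : L2Space d :=
  Complex.I • schro (-a s) (G (schro (a s) z))

/-- The propagators are isometric, so the Lipschitz constant does not depend on `a`; this is the
source of the uniformity in `ε`. -/
theorem norm_field_sub_le {d : ℕ} (a : ℝ → ℝ) {G : L2Space d → L2Space d} {L : ℝ≥0}
    (hG : LipschitzWith L G) (s : ℝ) (z w : L2Space d) :
    ‖field a G s z - field a G s w‖ ≤ L * ‖z - w‖ := by
  rw [field, field, ← smul_sub, norm_smul, Complex.norm_I, one_mul, ← map_sub, norm_schro]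
  refine (hG.norm_sub_le _ _).trans ?_
  rw [← map_sub, norm_schro]

theorem continuous_field {d : ℕ} {a : ℝ → ℝ} (ha : Continuous a) {G : L2Space d → L2Space d}
    (hG : Continuous G) {z : ℝ → L2Space d} (hz : Continuous z) :
    Continuous fun s => field a G s (z s) := by
  have h1 : Continuous fun s => schro (a s) (z s) := continuous_iff_continuousAt.2 fun s =>
    tendsto_schro (ha.tendsto s) (hz.tendsto s)
  have h2 : Continuous fun s => schro (-a s) (G (schro (a s) (z s))) :=
    continuous_iff_continuousAt.2 fun s =>
      tendsto_schro (ha.neg.tendsto s) ((hG.comp h1).tendsto s)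
  exact h2.const_smul Complex.I

theorem field_mem_H2Ball {d : ℕ} {q R C : ℝ} {a : ℝ → ℝ} {G : L2Space d → L2Space d}
    (hG : ∀ f : H2Space d, ‖f‖ ≤ R → nonlin q (toL2 f) = G (toL2 f))
    (hC : ∀ f : H2Space d, ‖f‖ ≤ R → ∃ g : H2Space d, toL2 g = nonlin q (toL2 f) ∧ ‖g‖ ≤ C)
    {s : ℝ} {z : L2Space d} (hz : z ∈ H2Ball d R) : field a G s z ∈ H2Ball d C := by
  obtain ⟨g, hg, hgR⟩ := schro_mem_H2Ball (a s) hz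
  refine I_smul_mem_H2Ball (schro_mem_H2Ball _ ?_)
  rw [← hg, ← hG g hgR]
  exact hC g hgR

/-- Solutions of the equation in the integral form of Duhamel, where `a` is a primitive of the
dispersion coefficient. -/
structure IsMildOn {d : ℕ} (q : ℝ) (a : ℝ → ℝ) (t₀ : ℝ) (φ : H2Space d) (T : ℝ)
    (u : ℝ → H2Space d) : Prop where
  continuousOn : ContinuousOn u (Icc t₀ T)
  duhamel : ∀ t ∈ Icc t₀ T, schro (-a t) (toL2 (u t)) = schro (-a t₀) (toL2 φ) +
    ∫ s in t₀..t, Complex.I • schro (-a s) (nonlin q (toL2 (u s)))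

/-- Banach's fixed point theorem for the Duhamel map, in the uniform `L²` metric on curves with
values in the `H²` ball. Closedness of the ball in `L²` gives completeness; `hCδ` keeps the ball
invariant and `hLδ` gives contraction by `1 / 2`. -/
theorem exists_integral_solution {d : ℕ} {a : ℝ → ℝ} (ha : Continuous a)
    {G : L2Space d → L2Space d} {L : ℝ≥0} (hG : LipschitzWith L G) {R R₀ C δ : ℝ} (hR₀ : 0 ≤ R₀)
    (hC : 0 ≤ C) (hδ : 0 < δ) (hLδ : L * δ ≤ 1 / 2) (hCδ : R₀ + C * δ ≤ R)
    (hB : ∀ s, ∀ z ∈ H2Ball d R, field a G s z ∈ H2Ball d C) (t₀ : ℝ) {ψ : L2Space d}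
    (hψ : ψ ∈ H2Ball d R₀) :
    ∃ z : ℝ → L2Space d, Continuous z ∧ (∀ t, z t ∈ H2Ball d R) ∧
      ∀ t ∈ Icc t₀ (t₀ + δ), z t = ψ + ∫ s in t₀..t, field a G s (z s) := by
  have hR : 0 ≤ R := by nlinarith
  have hle : t₀ ≤ t₀ + δ := by linarith
  set J := Icc t₀ (t₀ + δ)
  set ext : C(J, L2Space d) → ℝ → L2Space d := fun z s => z (projIcc t₀ (t₀ + δ) hle s) with hext
  have hextc : ∀ z, Continuous (ext z) := fun z => z.continuous.comp continuous_projIcc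
  have hfc : ∀ z, Continuous fun s => field a G s (ext z s) := fun z =>
    continuous_field ha hG.continuous (hextc z)
  set Φ : C(J, L2Space d) → C(J, L2Space d) := fun z =>
    ⟨fun t => ψ + ∫ s in t₀..t, field a G s (ext z s), by
      have := (intervalIntegral.continuous_primitive
        (μ := volume) (fun a b => (hfc z).intervalIntegrable a b) t₀).comp
        (continuous_subtype_val : Continuous (Subtype.val : J → ℝ))
      exact continuous_const.add this⟩ with hΦ
  have hΦa : ∀ z (t : J), Φ z t = ψ + ∫ s in t₀..t, field a G s (ext z s) := fun _ _ => rfl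
  set S : Set C(J, L2Space d) := {z | ∀ t, z t ∈ H2Ball d R} with hS
  have hSc : IsClosed S := by
    have : S = ⋂ t : J, (fun z : C(J, L2Space d) => z t) ⁻¹' (H2Ball d R) := by
      ext z; simp [hS]
    rw [this]
    exact isClosed_iInter fun t => (isClosed_H2Ball hR).preimage
      (continuous_eval_const t)
  have hmaps : MapsTo Φ S S := by
    intro z hz t
    rw [hΦa]
    have h1 := integral_mem_H2Ball hC t.2.1 ((hfc z).intervalIntegrable _ _)
      fun r _ => hB r _ (hz (projIcc t₀ (t₀ + δ) hle r))
    refine H2Ball_mono ?_ (add_mem_H2Ball hψ h1)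
    refine le_trans ?_ hCδ
    have := t.2.2
    gcongr
    linarith
  have hcontr : ContractingWith (1 / 2 : ℝ≥0) (hmaps.restrict Φ S S) := by
    refine ⟨by rw [div_lt_one (by norm_num)]; norm_num, LipschitzWith.of_dist_le_mul ?_⟩
    intro z w
    change dist (Φ z.1) (Φ w.1) ≤ _ * dist z.1 w.1
    rw [ContinuousMap.dist_le (by positivity)]
    intro t
    rw [hΦa, hΦa, dist_add_left, dist_eq_norm, ← intervalIntegral.integral_sub
      ((hfc z.1).intervalIntegrable _ _) ((hfc w.1).intervalIntegrable _ _)]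
    have hb : ∀ s ∈ uIoc t₀ (t : ℝ), ‖field a G s (ext z.1 s) - field a G s (ext w.1 s)‖ ≤
        L * dist z.1 w.1 := by
      intro s _
      refine (norm_field_sub_le a hG s _ _).trans ?_
      rw [← dist_eq_norm]
      gcongr
      exact ContinuousMap.dist_apply_le_dist _
    refine (intervalIntegral.norm_integral_le_of_norm_le_const hb).trans ?_
    have ht : |(t : ℝ) - t₀| ≤ δ := by
      rw [abs_of_nonneg (sub_nonneg.2 t.2.1)]
      linarith [t.2.2]
    calc _ ≤ L * dist z.1 w.1 * δ := by gcongr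
      _ = L * δ * dist z.1 w.1 := by ring
      _ ≤ 1 / 2 * dist z.1 w.1 := by gcongr
      _ = _ := by simp
  have hx₀ : ContinuousMap.const J ψ ∈ S := fun _ => H2Ball_mono (by nlinarith) hψ
  obtain ⟨z, hzS, hz, -⟩ := hcontr.exists_fixedPoint' hSc.isComplete hmaps hx₀ (edist_ne_top _ _)
  refine ⟨ext z, hextc z, fun t => hzS _, fun t ht => ?_⟩
  have h1 : ext z t = z ⟨t, ht⟩ := by rw [hext]; simp only [projIcc_of_mem hle ht]
  rw [h1]
  exact (congrArg (fun y : C(J, L2Space d) => y ⟨t, ht⟩) hz).symm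

/-- Local existence of mild solutions on a time interval whose length depends on the `H²` norm of
the datum only. -/
theorem exists_isMildOn {d : ℕ} (hd : d ≤ 3) {q : ℝ} (hq : 1 ≤ q) (M : ℝ) :
    ∃ δ : ℝ, 0 < δ ∧ ∀ (a : ℝ → ℝ), Continuous a → ∀ (t₀ : ℝ) (φ : H2Space d), ‖φ‖ ≤ M →
      ∃ u : ℝ → H2Space d, IsMildOn q a t₀ φ (t₀ + δ) u := by
  set R : ℝ := max M 0 + 1 with hR
  obtain ⟨C, hC0, hC⟩ := exists_nonlin_H2_bound hd hq R
  obtain ⟨G, L, hL, hG⟩ := exists_lipschitz_eq_nonlin hd hq R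
  have hD : 0 < 2 * (C + L + 1) := by positivity
  have hδ : 0 < 1 / (2 * (C + L + 1)) := by positivity
  -- `C` and `L` depend only on `R`, so this length is fixed before `a`, `t₀` and `φ`. It ensures `L
  -- * δ ≤ 1 / 2`, and `C * δ ≤ 1` fits the margin between `R` and the size of the datum.
  refine ⟨1 / (2 * (C + L + 1)), hδ, fun a ha t₀ φ hφ => ?_⟩
  set δ := 1 / (2 * (C + L + 1)) with hδdef
  have hLδ : L * δ ≤ 1 / 2 := by
    rw [hδdef, mul_one_div, div_le_iff₀ hD]
    linarith
  have hCδ : C * δ ≤ 1 := by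
    rw [hδdef, mul_one_div, div_le_iff₀ hD]
    have := L.2
    linarith
  have hB : ∀ s, ∀ z ∈ H2Ball d R, field a G s z ∈ H2Ball d C := fun s z hz =>
    field_mem_H2Ball hG hC hz
  have hψ : schro (-a t₀) (toL2 φ) ∈ H2Ball d (max M 0) :=
    schro_mem_H2Ball _ ⟨φ, rfl, hφ.trans (le_max_left _ _)⟩
  obtain ⟨z, hzc, hzR, hz⟩ := exists_integral_solution ha hL (le_max_right _ _) hC0 hδ hLδ
    (by rw [hR]; gcongr) hB t₀ hψ
  choose y hy hyR using hzR
  have hfi : ∀ s t, IntervalIntegrable (fun s => field a G s (z s)) volume s t :=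
    (continuous_field ha hL.continuous hzc).intervalIntegrable
  -- The fixed point is continuous only in `L²`. Continuity in `H²` is recovered since its
  -- increments are integrals of a field bounded by `C` in `H²`.
  have hylip : ∀ s ∈ Icc t₀ (t₀ + δ), ∀ t ∈ Icc t₀ (t₀ + δ), s ≤ t → ‖y t - y s‖ ≤ C * (t - s) := by
    intro s hs t ht hst
    have h1 : z t - z s = ∫ r in s..t, field a G r (z r) := by
      rw [hz t ht, hz s hs, add_sub_add_left_eq_sub,
        intervalIntegral.integral_interval_sub_left (hfi _ _) (hfi _ _)]
    obtain ⟨g, hg, hgC⟩ := integral_mem_H2Ball hC0 hst (hfi s t) fun r _ => hB r _ ⟨y r, hy r, hyR r⟩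
    have h2 : y t - y s = g := by
      apply toL2_injective
      rw [hg, ← h1, map_sub, hy, hy]
    rwa [h2]
  have hycont : ContinuousOn y (Icc t₀ (t₀ + δ)) := by
    refine LipschitzOnWith.continuousOn (K := ⟨C, hC0⟩) (LipschitzOnWith.of_dist_le_mul ?_)
    intro s hs t ht
    change dist (y s) (y t) ≤ C * dist s t
    rcases le_total s t with h | h
    · rw [dist_comm, dist_eq_norm, dist_comm, Real.dist_eq, abs_of_nonneg (sub_nonneg.2 h)]
      exact hylip s hs t ht h
    · rw [dist_eq_norm, Real.dist_eq, abs_of_nonneg (sub_nonneg.2 h)]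
      exact hylip t ht s hs h
  refine ⟨fun t => schroH2 (a t) (y t), fun t ht => tendsto_schroH2
    (ha.continuousWithinAt.tendsto) (hycont t ht), fun t ht => ?_⟩
  simp only [toL2_schroH2, hy, schro_neg_schro]
  rw [hz t ht]
  congr 1
  refine intervalIntegral.integral_congr fun s _ => ?_
  simp only [field]
  rw [← hy s, ← toL2_schroH2, hG _ ((norm_schroH2 _ _).trans_le (hyR s))]

/-! ### Uniqueness and gluing of mild solutions. -/

theorem exists_bound_of_continuousOn_Icc {d : ℕ} {u : ℝ → H2Space d} {t₀ T : ℝ}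
    (hu : ContinuousOn u (Icc t₀ T)) : ∃ R, ∀ t ∈ Icc t₀ T, ‖u t‖ ≤ R :=
  isCompact_Icc.exists_bound_of_continuousOn hu

theorem continuousOn_nonlin {d : ℕ} (hd : d ≤ 3) {q : ℝ} (hq : 1 ≤ q) {u : ℝ → H2Space d}
    {t₀ T : ℝ} (hu : ContinuousOn u (Icc t₀ T)) :
    ContinuousOn (fun s => nonlin q (toL2 (u s))) (Icc t₀ T) := by
  obtain ⟨R, hR⟩ := exists_bound_of_continuousOn_Icc hu
  obtain ⟨G, L, hL, hG⟩ := exists_lipschitz_eq_nonlin hd hq R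
  exact ((hL.continuous.comp continuous_toL2).comp_continuousOn hu).congr fun s hs =>
    hG _ (hR s hs)

theorem continuousOn_forcing {d : ℕ} (hd : d ≤ 3) {q : ℝ} (hq : 1 ≤ q) {a : ℝ → ℝ}
    (ha : Continuous a) {u : ℝ → H2Space d} {t₀ T : ℝ} (hu : ContinuousOn u (Icc t₀ T)) :
    ContinuousOn (fun s => Complex.I • schro (-a s) (nonlin q (toL2 (u s)))) (Icc t₀ T) := by
  have h : ContinuousOn (fun s => schro (-a s) (nonlin q (toL2 (u s)))) (Icc t₀ T) := fun s hs =>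
    tendsto_schro ha.neg.continuousWithinAt.tendsto (continuousOn_nonlin hd hq hu s hs)
  exact h.const_smul Complex.I

theorem IsMildOn.mono {d : ℕ} {q : ℝ} {a : ℝ → ℝ} {t₀ T T' : ℝ} {φ : H2Space d}
    {u : ℝ → H2Space d} (hu : IsMildOn q a t₀ φ T u) (h : T' ≤ T) : IsMildOn q a t₀ φ T' u :=
  ⟨hu.continuousOn.mono (Icc_subset_Icc_right h),
    fun t ht => hu.duhamel t (Icc_subset_Icc_right h ht)⟩

theorem IsMildOn.initial {d : ℕ} {q : ℝ} {a : ℝ → ℝ} {t₀ T : ℝ} {φ : H2Space d}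
    {u : ℝ → H2Space d} (hu : IsMildOn q a t₀ φ T u) (h : t₀ ≤ T) : u t₀ = φ := by
  have h1 := congrArg (schro (a t₀)) (hu.duhamel t₀ (left_mem_Icc.2 h))
  rw [intervalIntegral.integral_same, add_zero, schro_schro_neg, schro_schro_neg] at h1
  exact toL2_injective h1

theorem IsMildOn.congr {d : ℕ} {q : ℝ} {a : ℝ → ℝ} {t₀ T : ℝ} {φ : H2Space d}
    {u v : ℝ → H2Space d} (hu : IsMildOn q a t₀ φ T u) (h : EqOn v u (Icc t₀ T)) :
    IsMildOn q a t₀ φ T v := by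
  refine ⟨hu.continuousOn.congr h, fun t ht => ?_⟩
  rw [h ht, hu.duhamel t ht]
  congr 1
  refine intervalIntegral.integral_congr fun s hs => ?_
  rw [uIcc_of_le ht.1] at hs
  simp only [h ⟨hs.1, hs.2.trans ht.2⟩]

/-- Freezing the forcing outside the interval yields a curve with two-sided derivatives also at the
end points. -/
theorem IsMildOn.hasDerivAt_extension {d : ℕ} (hd : d ≤ 3) {q : ℝ} (hq : 1 ≤ q) {a : ℝ → ℝ}
    (ha : Continuous a) {t₀ T : ℝ} (hT : t₀ ≤ T) {φ : H2Space d} {u : ℝ → H2Space d}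
    (hu : IsMildOn q a t₀ φ T u) :
    ∃ z : ℝ → L2Space d, (∀ t ∈ Icc t₀ T, z t = schro (-a t) (toL2 (u t))) ∧
      ∀ t ∈ Icc t₀ T, HasDerivAt z (Complex.I • schro (-a t) (nonlin q (toL2 (u t)))) t := by
  set F := fun s => Complex.I • schro (-a s) (nonlin q (toL2 (u s)))
  set E : ℝ → L2Space d := fun s => F (projIcc t₀ T hT s) with hE
  have hEF : ∀ s ∈ Icc t₀ T, E s = F s := fun s hs => by
    simp only [hE, projIcc_of_mem hT hs]
  have hc : Continuous E :=
    (continuousOn_forcing hd hq ha hu.continuousOn).comp_continuous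
      (continuous_subtype_val.comp continuous_projIcc) fun s => (projIcc t₀ T hT s).2
  refine ⟨fun t => schro (-a t₀) (toL2 φ) + ∫ s in t₀..t, E s, fun t ht => ?_, fun t ht => ?_⟩
  · rw [hu.duhamel t ht]
    have h2 : ∫ s in t₀..t, E s = ∫ s in t₀..t, F s := by
      refine intervalIntegral.integral_congr fun s hs => ?_
      rw [uIcc_of_le ht.1] at hs
      exact hEF s ⟨hs.1, hs.2.trans ht.2⟩
    exact congrArg (schro (-a t₀) (toL2 φ) + ·) h2
  · have h1 : HasDerivAt (fun t => ∫ s in t₀..t, E s) (E t) t :=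
      intervalIntegral.integral_hasDerivAt_right (hc.intervalIntegrable t₀ t)
        (hc.stronglyMeasurableAtFilter _ _) hc.continuousAt
    rw [hEF t ht] at h1
    exact h1.const_add (schro (-a t₀) (toL2 φ))

/-- Both solutions are bounded in `H²` on the compact interval, so a single Lipschitz `G` serves
both, and Gronwall's inequality applies in `L²`. -/
theorem IsMildOn.eqOn {d : ℕ} (hd : d ≤ 3) {q : ℝ} (hq : 1 ≤ q) {a : ℝ → ℝ}
    (ha : Continuous a) {t₀ T : ℝ} {φ : H2Space d} {u v : ℝ → H2Space d}
    (hu : IsMildOn q a t₀ φ T u) (hv : IsMildOn q a t₀ φ T v) : EqOn u v (Icc t₀ T) := by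
  rcases lt_or_ge T t₀ with hT | hT
  · rw [Icc_eq_empty (not_le.2 hT)]
    exact eqOn_empty _ _
  obtain ⟨R₁, hR₁⟩ := exists_bound_of_continuousOn_Icc hu.continuousOn
  obtain ⟨R₂, hR₂⟩ := exists_bound_of_continuousOn_Icc hv.continuousOn
  obtain ⟨G, L, hL, hG⟩ := exists_lipschitz_eq_nonlin hd hq (max R₁ R₂)
  obtain ⟨z, hz, hz'⟩ := hu.hasDerivAt_extension hd hq ha hT
  obtain ⟨w, hw, hw'⟩ := hv.hasDerivAt_extension hd hq ha hT
  have hzd : ∀ t ∈ Icc t₀ T, HasDerivAt z (field a G t (z t)) t := by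
    intro t ht
    rw [hz t ht, field, schro_schro_neg, ← hG _ ((hR₁ t ht).trans (le_max_left _ _))]
    exact hz' t ht
  have hwd : ∀ t ∈ Icc t₀ T, HasDerivAt w (field a G t (w t)) t := by
    intro t ht
    rw [hw t ht, field, schro_schro_neg, ← hG _ ((hR₂ t ht).trans (le_max_right _ _))]
    exact hw' t ht
  have h0 : z t₀ = w t₀ := by
    rw [hz t₀ (left_mem_Icc.2 hT), hw t₀ (left_mem_Icc.2 hT), hu.initial hT, hv.initial hT]
  have key : EqOn z w (Icc t₀ T) :=
    ODE_solution_unique_of_mem_Icc_right (v := field a G) (s := fun _ => univ) (K := L)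
      (fun t _ => (LipschitzWith.of_dist_le_mul fun x y => by
        rw [dist_eq_norm, dist_eq_norm]; exact norm_field_sub_le a hL t x y).lipschitzOnWith)
      (fun t ht => (hzd t ht).continuousAt.continuousWithinAt)
      (fun t ht => (hzd t (Ico_subset_Icc_self ht)).hasDerivWithinAt) (fun _ _ => mem_univ _)
      (fun t ht => (hwd t ht).continuousAt.continuousWithinAt)
      (fun t ht => (hwd t (Ico_subset_Icc_self ht)).hasDerivWithinAt) (fun _ _ => mem_univ _) h0
  intro t ht
  have h1 := congrArg (schro (a t)) ((hz t ht).symm.trans ((key ht).trans (hw t ht)))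
  rw [schro_schro_neg, schro_schro_neg] at h1
  exact toL2_injective h1

theorem IsMildOn.glue {d : ℕ} (hd : d ≤ 3) {q : ℝ} (hq : 1 ≤ q) {a : ℝ → ℝ}
    (ha : Continuous a) {t₀ T₁ T₂ : ℝ} (h₀₁ : t₀ ≤ T₁) (h₁₂ : T₁ ≤ T₂) {φ : H2Space d}
    {u v : ℝ → H2Space d} (hu : IsMildOn q a t₀ φ T₁ u) (hv : IsMildOn q a T₁ (u T₁) T₂ v) :
    ∃ w, IsMildOn q a t₀ φ T₂ w := by
  set w : ℝ → H2Space d := fun t => if t ≤ T₁ then u t else v t with hw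
  have hwu : EqOn w u (Icc t₀ T₁) := fun t ht => if_pos ht.2
  have hwv : EqOn w v (Icc T₁ T₂) := by
    intro t ht
    rcases ht.1.eq_or_lt with rfl | h
    · simp only [hw, le_refl, if_true]
      exact (hv.initial h₁₂).symm
    · exact if_neg (not_le.2 h)
  have hu' := hu.congr hwu
  have hv' := hv.congr hwv
  have hwc : ContinuousOn w (Icc t₀ T₂) := by
    rw [← Icc_union_Icc_eq_Icc h₀₁ h₁₂]
    exact hu'.continuousOn.union_of_isClosed hv'.continuousOn isClosed_Icc isClosed_Icc
  refine ⟨w, hwc, fun t ht => ?_⟩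
  rcases le_total t T₁ with h | h
  · exact hu'.duhamel t ⟨ht.1, h⟩
  · have hf := continuousOn_forcing hd hq ha hwc
    rw [hv'.duhamel t ⟨h, ht.2⟩, ← hwu (right_mem_Icc.2 h₀₁), hu'.duhamel T₁ (right_mem_Icc.2 h₀₁),
      add_assoc, intervalIntegral.integral_add_adjacent_intervals]
    · exact (hf.mono (Icc_subset_Icc_right h₁₂)).intervalIntegrable_of_Icc h₀₁
    · exact (hf.mono (Icc_subset_Icc h₀₁ ht.2)).intervalIntegrable_of_Icc h

/-! ### The dispersion map and its primitive. -/

theorem measurable_dispersionMap (γp γm tp : ℝ) : Measurable (dispersionMap γp γm tp) := by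
  unfold dispersionMap
  exact Measurable.ite ((measurableSet_lt measurable_const measurable_fract).inter
    (measurableSet_le measurable_fract measurable_const)) measurable_const measurable_const

theorem abs_dispersionMap_le (γp γm tp t : ℝ) : |dispersionMap γp γm tp t| ≤ |γp| + |γm| := by
  unfold dispersionMap
  split_ifs
  · linarith [abs_nonneg γm]
  · rw [abs_neg]; linarith [abs_nonneg γp]

theorem intervalIntegrable_dispersionMap (γp γm tp ε s t : ℝ) :
    IntervalIntegrable (fun r => dispersionMap γp γm tp (r / ε)) volume s t := by
  refine (intervalIntegrable_const (c := |γp| + |γm|)).mono_fun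
    ((measurable_dispersionMap γp γm tp).comp (measurable_id.div_const ε)).aestronglyMeasurable
    (Eventually.of_forall fun r => ?_)
  simp only [Real.norm_eq_abs]
  exact (abs_dispersionMap_le _ _ _ _).trans (le_abs_self _)

/-- The accumulated dispersion `∫₀ᵗ γ(s/ε) ds`. -/
def cumulDispersion (γp γm tp ε t : ℝ) : ℝ := ∫ s in (0 : ℝ)..t, dispersionMap γp γm tp (s / ε)

theorem continuous_cumulDispersion (γp γm tp ε : ℝ) : Continuous (cumulDispersion γp γm tp ε) :=
  intervalIntegral.continuous_primitive
    (fun s t => intervalIntegrable_dispersionMap γp γm tp ε s t) 0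

theorem hasDerivAt_cumulDispersion {γp γm tp ε t : ℝ}
    (ht : ContinuousAt (fun s => dispersionMap γp γm tp (s / ε)) t) :
    HasDerivAt (cumulDispersion γp γm tp ε) (dispersionMap γp γm tp (t / ε)) t :=
  intervalIntegral.integral_hasDerivAt_right (intervalIntegrable_dispersionMap γp γm tp ε 0 t)
    ((measurable_dispersionMap γp γm tp).comp
      (measurable_id.div_const ε)).stronglyMeasurable.stronglyMeasurableAtFilter ht

theorem continuousAt_dispersionMap {γp γm tp t : ℝ} (h0 : Int.fract t ≠ 0)
    (h1 : Int.fract t ≠ tp) : ContinuousAt (dispersionMap γp γm tp) t := by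
  have hf : ContinuousAt Int.fract t := continuousAt_fract fun h => h0 (by rw [h, Int.fract_intCast])
  have hpos : 0 < Int.fract t := lt_of_le_of_ne (Int.fract_nonneg t) h0.symm
  rcases lt_or_gt_of_ne h1 with h | h
  · refine (continuousAt_const (y := γp)).congr ?_
    filter_upwards [hf.eventually (lt_mem_nhds hpos), hf.eventually (gt_mem_nhds h)] with s h2 h3
    exact (if_pos ⟨h2, h3.le⟩).symm
  · refine (continuousAt_const (y := -γm)).congr ?_
    filter_upwards [hf.eventually (lt_mem_nhds h)] with s h2
    exact (if_neg fun h3 => absurd h3.2 (not_le.2 h2)).symm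

theorem countable_not_continuousAt_dispersionMap (γp γm tp : ℝ) {ε : ℝ} (hε : 0 < ε) :
    {t | ¬ ContinuousAt (fun s => dispersionMap γp γm tp (s / ε)) t}.Countable := by
  have hc : (range fun n : ℤ => (n : ℝ) * ε) ∪ (range fun n : ℤ => ((n : ℝ) + tp) * ε) |>.Countable :=
    (countable_range _).union (countable_range _)
  refine hc.mono fun t ht => ?_
  by_contra hn
  rw [mem_union, not_or] at hn
  apply ht
  have hfl : (⌊t / ε⌋ : ℝ) + Int.fract (t / ε) = t / ε := Int.floor_add_fract _
  refine ContinuousAt.comp (g := dispersionMap γp γm tp) (f := fun s => s / ε)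
    (continuousAt_dispersionMap (fun h => hn.1 ⟨⌊t / ε⌋, ?_⟩) fun h => hn.2 ⟨⌊t / ε⌋, ?_⟩)
    (continuousAt_id.div_const ε)
  · rw [h, add_zero] at hfl
    simp only [hfl]
    field_simp
  · rw [h] at hfl
    simp only [hfl]
    field_simp

/-! ### Equivalence of strong and mild solutions. -/

theorem equation_ae_iff {d : ℕ} (hd : d ≤ 3) {p : ℝ} (hp : 2 ≤ p) (γ : ℝ) (f : H2Space d)
    (f' : L2Space d) :
    (∀ᵐ x : EuclideanSpace ℝ (Fin d), Complex.I * f' x + (γ : ℂ) * laplace f x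
      + ((‖toL2 f x‖ ^ (p - 1) : ℝ) : ℂ) * toL2 f x = 0) ↔
    f' = Complex.I • nonlin (p - 1) (toL2 f) + (γ : ℂ) • Complex.I • laplace f := by
  obtain ⟨S, -, hS⟩ := exists_ae_norm_le hd
  have hn := coeFn_nonlin (q := p - 1) (by linarith) (hS f)
  have hr : (Complex.I • nonlin (p - 1) (toL2 f) + (γ : ℂ) • Complex.I • laplace f : L2Space d)
      =ᵐ[volume] fun x => Complex.I * (((‖toL2 f x‖ ^ (p - 1) : ℝ) : ℂ) * toL2 f x) +
        (γ : ℂ) * (Complex.I * laplace f x) := by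
    filter_upwards [hn, Lp.coeFn_add (Complex.I • nonlin (p - 1) (toL2 f))
      ((γ : ℂ) • Complex.I • laplace f), Lp.coeFn_smul Complex.I (nonlin (p - 1) (toL2 f)),
      Lp.coeFn_smul (γ : ℂ) (Complex.I • laplace f), Lp.coeFn_smul Complex.I (laplace f)]
      with x h1 h2 h3 h4 h5
    rw [h2, Pi.add_apply, h3, Pi.smul_apply, h1, h4, Pi.smul_apply, h5, Pi.smul_apply, powNL]
    simp only [smul_eq_mul]
  constructor
  · intro h
    apply Lp.ext
    filter_upwards [h, hr] with x h1 h2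
    rw [h2]
    linear_combination -Complex.I * h1 + f' x * Complex.I_mul_I
  · intro h
    subst h
    filter_upwards [hr] with x h2
    rw [h2]
    linear_combination (((‖toL2 f x‖ ^ (p - 1) : ℝ) : ℂ) * toL2 f x + (γ : ℂ) * laplace f x) *
      Complex.I_mul_I

section
variable {d : ℕ} {p γp γm tp ε t₀ T : ℝ} {φ : H2Space d} {u v : ℝ → H2Space d}

/-- Away from the jumps, differentiating `exp(-iaΔ) u` cancels the Laplacian. The curve is
continuous in `L²` across the countably many jumps, so the fundamental theorem of calculus still
gives Duhamel's formula. -/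
theorem IsSolutionOn.isMildOn (hd : d ≤ 3) (hp : 2 ≤ p) (hε : 0 < ε)
    (hu : IsSolutionOn p γp γm tp ε t₀ φ T u) :
    IsMildOn (p - 1) (cumulDispersion γp γm tp ε) t₀ φ T u := by
  set a := cumulDispersion γp γm tp ε with ha
  have hac : Continuous a := continuous_cumulDispersion γp γm tp ε
  refine ⟨hu.continuousOn, fun t ht => ?_⟩
  have hcont := hu.continuousOn.mono (Icc_subset_Icc_right ht.2)
  have hz : ContinuousOn (fun s => schro (-a s) (toL2 (u s))) (Icc t₀ t) := fun s hs =>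
    tendsto_schro hac.neg.continuousWithinAt.tendsto
      ((continuous_toL2.tendsto _).comp (hcont s hs))
  have hint : IntervalIntegrable
      (fun s => Complex.I • schro (-a s) (nonlin (p - 1) (toL2 (u s)))) volume t₀ t :=
    (continuousOn_forcing hd (by linarith) hac hcont).intervalIntegrable_of_Icc ht.1
  have key := integral_eq_of_hasDerivAt_off_countable_of_le _ _ ht.1
    (countable_not_continuousAt_dispersionMap γp γm tp hε) hz (fun s hs => by
      have hsc : ContinuousAt (fun s => dispersionMap γp γm tp (s / ε)) s := not_not.1 hs.2
      obtain ⟨u', hu', heq⟩ := hu.equation s ⟨hs.1.1, hs.1.2.trans_le ht.2⟩ hsc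
      rw [equation_ae_iff hd hp] at heq
      have hd1 := HasDerivAt.schro_apply (hasDerivAt_cumulDispersion hsc).neg hu' rfl
      have e : schro (-a s) u' + ((-dispersionMap γp γm tp (s / ε) : ℝ) : ℂ) •
          Complex.I • schro (-a s) (laplace (u s)) =
          Complex.I • schro (-a s) (nonlin (p - 1) (toL2 (u s))) := by
        rw [heq]
        simp only [map_add, map_smul, Complex.ofReal_neg, neg_smul]
        abel
      rw [← e]
      exact hd1) hint
  rw [key, hu.initial]
  abel

/-- The interaction-picture curve is differentiable at all times; only the primitive `a` fails to
be, and only at jumps. The product rule at the other times restores the Laplacian. -/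
theorem IsMildOn.isSolutionOn (hd : d ≤ 3) (hp : 2 ≤ p) (hT : t₀ ≤ T)
    (hu : IsMildOn (p - 1) (cumulDispersion γp γm tp ε) t₀ φ T u) :
    IsSolutionOn p γp γm tp ε t₀ φ T u := by
  set a := cumulDispersion γp γm tp ε with ha
  have hac : Continuous a := continuous_cumulDispersion γp γm tp ε
  refine ⟨hu.continuousOn, hu.initial hT, fun t ht hc => ?_⟩
  obtain ⟨z, hz, hz'⟩ := hu.hasDerivAt_extension hd (by linarith) hac hT
  have ht' := Ioo_subset_Icc_self ht
  refine ⟨_, ?_, (equation_ae_iff hd hp _ _ _).2 rfl⟩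
  have hd1 := HasDerivAt.schro_apply (f := schroH2 (-a t) (u t)) (hasDerivAt_cumulDispersion hc)
    (hz' t ht') (by rw [hz t ht', toL2_schroH2])
  have e : schro (a t) (Complex.I • schro (-a t) (nonlin (p - 1) (toL2 (u t)))) +
      ((dispersionMap γp γm tp (t / ε) : ℝ) : ℂ) •
        Complex.I • schro (a t) (laplace (schroH2 (-a t) (u t))) =
      Complex.I • nonlin (p - 1) (toL2 (u t)) +
        ((dispersionMap γp γm tp (t / ε) : ℝ) : ℂ) • Complex.I • laplace (u t) := by
    rw [map_smul, schro_schro_neg, laplace_schroH2, schro_schro_neg]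
  rw [← e]
  refine HasDerivAt.congr_of_eventuallyEq hd1 ?_
  filter_upwards [Ioo_mem_nhds ht.1 ht.2] with s hs
  rw [hz s (Ioo_subset_Icc_self hs)]
  exact (schro_schro_neg _ _).symm

theorem IsSolutionOn.mono {T' : ℝ} (hu : IsSolutionOn p γp γm tp ε t₀ φ T u) (h : T' ≤ T) :
    IsSolutionOn p γp γm tp ε t₀ φ T' u :=
  ⟨hu.continuousOn.mono (Icc_subset_Icc_right h), hu.initial,
    fun t ht => hu.equation t ⟨ht.1, ht.2.trans_le h⟩⟩

theorem IsSolutionOn.congr (hT : t₀ ≤ T) (hu : IsSolutionOn p γp γm tp ε t₀ φ T u)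
    (h : EqOn v u (Icc t₀ T)) : IsSolutionOn p γp γm tp ε t₀ φ T v := by
  refine ⟨hu.continuousOn.congr h, (h (left_mem_Icc.2 hT)).trans hu.initial, fun t ht hc => ?_⟩
  obtain ⟨u', hu', heq⟩ := hu.equation t ht hc
  refine ⟨u', hu'.congr_of_eventuallyEq ?_, ?_⟩
  · filter_upwards [Ioo_mem_nhds ht.1 ht.2] with s hs
    rw [h (Ioo_subset_Icc_self hs)]
  · rwa [h (Ioo_subset_Icc_self ht)]

theorem IsSolutionOn.eqOn (hd : d ≤ 3) (hp : 2 ≤ p) (hε : 0 < ε)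
    (hu : IsSolutionOn p γp γm tp ε t₀ φ T u) (hv : IsSolutionOn p γp γm tp ε t₀ φ T v) :
    EqOn u v (Icc t₀ T) :=
  (hu.isMildOn hd hp hε).eqOn hd (by linarith) (continuous_cumulDispersion γp γm tp ε)
    (hv.isMildOn hd hp hε)

/-! ### The maximal time, the maximal solution and blow-up. -/

theorem IsSolutionOn.le_maxTime (hT : t₀ < T) (hu : IsSolutionOn p γp γm tp ε t₀ φ T u) :
    (T : EReal) ≤ maxTime p γp γm tp ε t₀ φ :=
  le_sSup ⟨T, rfl, hT, u, hu⟩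

theorem exists_isSolutionOn_of_lt_maxTime
    (hT : (T : EReal) < maxTime p γp γm tp ε t₀ φ) :
    ∃ v : ℝ → H2Space d, IsSolutionOn p γp γm tp ε t₀ φ T v := by
  obtain ⟨τ, ⟨T', rfl, -, v, hv⟩, hlt⟩ := lt_sSup_iff.1 hT
  exact ⟨v, hv.mono (EReal.coe_lt_coe_iff.1 hlt).le⟩

/-- The mild form is kept alongside the strong one because continuation glues mild solutions, where
no time derivative has to be matched at the junction. -/
theorem exists_isSolutionOn (hd : d ≤ 3) (hp : 2 ≤ p) (γp γm tp M : ℝ) :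
    ∃ δ : ℝ, 0 < δ ∧ ∀ (ε t₀ : ℝ) (φ : H2Space d), ‖φ‖ ≤ M →
      ∃ u, IsMildOn (p - 1) (cumulDispersion γp γm tp ε) t₀ φ (t₀ + δ) u ∧
        IsSolutionOn p γp γm tp ε t₀ φ (t₀ + δ) u := by
  obtain ⟨δ, hδ, h⟩ := exists_isMildOn hd (q := p - 1) (by linarith) M
  refine ⟨δ, hδ, fun ε t₀ φ hφ => ?_⟩
  obtain ⟨u, hu⟩ := h _ (continuous_cumulDispersion γp γm tp ε) t₀ φ hφ
  exact ⟨u, hu, hu.isSolutionOn hd hp (by linarith)⟩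

/-- The existence time is bounded below in terms of the `H²` norm of the datum, uniformly in the
period of the dispersion map. -/
theorem exists_add_le_maxTime (hd : d ≤ 3) (hp : 2 ≤ p) (γp γm tp M : ℝ) :
    ∃ δ : ℝ, 0 < δ ∧ ∀ (ε t₀ : ℝ) (φ : H2Space d), ‖φ‖ ≤ M →
      ((t₀ + δ : ℝ) : EReal) ≤ maxTime p γp γm tp ε t₀ φ := by
  obtain ⟨δ, hδ, h⟩ := exists_isSolutionOn (d := d) hd hp γp γm tp M
  refine ⟨δ, hδ, fun ε t₀ φ hφ => ?_⟩
  obtain ⟨u, -, hu⟩ := h ε t₀ φ hφ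
  exact hu.le_maxTime (by linarith)

theorem lt_maxTime (hd : d ≤ 3) (hp : 2 ≤ p) (γp γm tp ε t₀ : ℝ) (φ : H2Space d) :
    (t₀ : EReal) < maxTime p γp γm tp ε t₀ φ := by
  obtain ⟨δ, hδ, h⟩ := exists_add_le_maxTime (d := d) hd hp γp γm tp ‖φ‖
  exact (EReal.coe_lt_coe_iff.2 (by linarith)).trans_le (h ε t₀ φ le_rfl)

/-- The maximal solution. -/
theorem exists_maximal_solution (hd : d ≤ 3) (hp : 2 ≤ p) (hε : 0 < ε) (t₀ : ℝ) (φ : H2Space d) :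
    ∃ u : ℝ → H2Space d, ∀ T : ℝ, t₀ < T → (T : EReal) < maxTime p γp γm tp ε t₀ φ →
      IsSolutionOn p γp γm tp ε t₀ φ T u := by
  have h : ∀ T : ℝ, ∃ v : ℝ → H2Space d, (T : EReal) < maxTime p γp γm tp ε t₀ φ →
      IsSolutionOn p γp γm tp ε t₀ φ T v := fun T => by
    by_cases hT : (T : EReal) < maxTime p γp γm tp ε t₀ φ
    · obtain ⟨v, hv⟩ := exists_isSolutionOn_of_lt_maxTime hT
      exact ⟨v, fun _ => hv⟩
    · exact ⟨0, fun h => absurd h hT⟩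
  choose v hv using h
  -- Diagonal choice: by uniqueness, the solution chosen for `t` agrees at `t` with the one chosen
  -- for any later `T`.
  refine ⟨fun t => v t t, fun T hT hTm => (hv T hTm).congr hT.le fun t ht => ?_⟩
  have htm : (t : EReal) < maxTime p γp γm tp ε t₀ φ :=
    (EReal.coe_le_coe_iff.2 ht.2).trans_lt hTm
  exact (hv t htm).eqOn hd hp hε ((hv T hTm).mono ht.2) (right_mem_Icc.2 ht.1)

/-- If the norm were at most `M` at any single time within `δ` of `Tmax`, restarting there would
extend the solution beyond `Tmax`. This excludes every such time, which gives a limit and not just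
unboundedness. -/
theorem tendsto_norm_maximal_solution (hd : d ≤ 3) (hp : 2 ≤ p) (hε : 0 < ε) {Tmax : ℝ}
    (hm : maxTime p γp γm tp ε t₀ φ = (Tmax : EReal))
    (hu : ∀ T : ℝ, t₀ < T → (T : EReal) < maxTime p γp γm tp ε t₀ φ →
      IsSolutionOn p γp γm tp ε t₀ φ T u) :
    Tendsto (fun t => ‖u t‖) (𝓝[<] Tmax) atTop := by
  have ht₀ : t₀ < Tmax := by
    have := lt_maxTime hd hp γp γm tp ε t₀ φ
    rwa [hm, EReal.coe_lt_coe_iff] at this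
  rw [tendsto_atTop]
  intro M
  obtain ⟨δ, hδ, h⟩ := exists_isSolutionOn (d := d) hd hp γp γm tp M
  filter_upwards [Ioo_mem_nhdsLT (max_lt ht₀ (by linarith : Tmax - δ < Tmax))] with t ht
  by_contra hlt
  have ht1 : t₀ < t := (le_max_left _ _).trans_lt ht.1
  have ht2 : Tmax - δ < t := (le_max_right _ _).trans_lt ht.1
  obtain ⟨v, hv, -⟩ := h ε t (u t) (not_le.1 hlt).le
  have hut := (hu t ht1 (by rw [hm]; exact EReal.coe_lt_coe_iff.2 ht.2)).isMildOn hd hp hε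
  obtain ⟨w, hw⟩ := hut.glue hd (by linarith) (continuous_cumulDispersion γp γm tp ε) ht1.le
    (by linarith) hv
  have := (hw.isSolutionOn hd hp (by linarith)).le_maxTime (by linarith)
  rw [hm, EReal.coe_le_coe_iff] at this
  linarith

end

end DispersionNLS

end

theorem lemma4p2 (d : ℕ) (hd : 1 ≤ d) (hd3 : d ≤ 3) (p : ℝ) (hp : 2 ≤ p)
    (γp γm tp : ℝ) (hγp : 0 < γp) (hγm : 0 < γm) (htp0 : 0 < tp) (htp1 : tp < 1) :
    -- for each `ε`, `t₀`, `φ`: the maximal solution, its uniqueness, the blow-up alternative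
    (∀ ε : ℝ, 0 < ε → ∀ (t₀ : ℝ) (φ : DispersionNLS.H2Space d),
      (t₀ : EReal) < DispersionNLS.maxTime p γp γm tp ε t₀ φ ∧
      ∃ u : ℝ → DispersionNLS.H2Space d,
        (∀ T : ℝ, t₀ < T → (T : EReal) < DispersionNLS.maxTime p γp γm tp ε t₀ φ →
          DispersionNLS.IsSolutionOn p γp γm tp ε t₀ φ T u ∧
          ∀ v : ℝ → DispersionNLS.H2Space d,
            DispersionNLS.IsSolutionOn p γp γm tp ε t₀ φ T v → EqOn v u (Icc t₀ T)) ∧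
        (∀ Tmax : ℝ, DispersionNLS.maxTime p γp γm tp ε t₀ φ = (Tmax : EReal) →
          Tendsto (fun t => ‖u t‖) (𝓝[<] Tmax) atTop)) ∧
    -- for each `ε`, the existence time is bounded below in terms of the norm of the datum
    (∀ ε : ℝ, 0 < ε → ∀ M : ℝ, ∃ δ : ℝ, 0 < δ ∧
      ∀ (t₀ : ℝ) (φ : DispersionNLS.H2Space d), ‖φ‖ ≤ M →
        ((t₀ + δ : ℝ) : EReal) ≤ DispersionNLS.maxTime p γp γm tp ε t₀ φ) ∧
    -- and this bound is uniform for `0 < ε ≤ 1`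
    (∀ M : ℝ, ∃ δ : ℝ, 0 < δ ∧ ∀ ε : ℝ, 0 < ε → ε ≤ 1 →
      ∀ (t₀ : ℝ) (φ : DispersionNLS.H2Space d), ‖φ‖ ≤ M →
        ((t₀ + δ : ℝ) : EReal) ≤ DispersionNLS.maxTime p γp γm tp ε t₀ φ) := by
  refine ⟨fun ε hε t₀ φ => ⟨DispersionNLS.lt_maxTime hd3 hp γp γm tp ε t₀ φ, ?_⟩,
    fun ε hε M => ?_, fun M => ?_⟩
  · obtain ⟨u, hu⟩ := DispersionNLS.exists_maximal_solution (γp := γp) (γm := γm) (tp := tp)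
      hd3 hp hε t₀ φ
    exact ⟨u, fun T hT hTm => ⟨hu T hT hTm, fun v hv => hv.eqOn hd3 hp hε (hu T hT hTm)⟩,
      fun Tmax hm => DispersionNLS.tendsto_norm_maximal_solution hd3 hp hε hm hu⟩
  · obtain ⟨δ, hδ, h⟩ := DispersionNLS.exists_add_le_maxTime (d := d) hd3 hp γp γm tp M
    exact ⟨δ, hδ, fun t₀ φ hφ => h ε t₀ φ hφ⟩
  · obtain ⟨δ, hδ, h⟩ := DispersionNLS.exists_add_le_maxTime (d := d) hd3 hp γp γm tp M
    exact ⟨δ, hδ, fun ε _ _ t₀ φ hφ => h ε t₀ φ hφ⟩
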